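/- **Setting.** Let $d\ge 2$. A *combinatorial datum* $\pi=(\pi_t,\pi_b)$ is a pair of bijections from positions $\{1,\dots,d\}$ to labels $\{1,\dots,d\}$; it is *irreducible* if $\pi_t\{1,\dots,k\}\ne\pi_b\{1,\dots,k\}$ for $1\le k<d$. A *$\mathcal C^1$-GIET* $T$ of $d$ intervals is given by an irreducible $\pi$, two partitions (up to endpoints) of $[0,1]$ into open intervals $I^t_j$ and $I^b_j$, ordered from left to right as $I^t_{\pi_t(1)},\dots,I^t_{\pi_t(d)}$ and $I^b_{\pi_b(1)},\dots,I^b_{\pi_b(d)}$, and branches $T_j$ which are orientation preserving $\mathcal C^1$-diffeomorphisms of $\overline{I^t_j}$ onto $\overline{I^b_j}$; as a map, $T=T_j$ on $I^t_j$, and $T$ is taken right-continuous on $[0,1)$. $T$ is a *standard IET* if all $T_j$ are translations; $\mathcal I_d$ is the set of standard IETs of $d$ intervals. *Distance.* Let $\lambda_j=|I^t_j|$, $\rho_j=|I^b_j|/|I^t_j|$, and let $\varphi^j_T\in\mathrm{Diff}^1([0,1])$ be $T_j$ rescaled affinely in domain and range. Then $d_{\mathcal C^1}(T,S)$ is the maximum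 of the discrete distance ($0$ or $1$) of the combinatorial data, the Euclidean distance of $(\lambda,\rho)(T)$ and $(\lambda,\rho)(S)$ in $\mathbb R^{2d}$, and $\sum_j\big(\|\varphi_T^j-\varphi_S^j\|_\infty+\|(\varphi_T^j-\varphi_S^j)'\|_\infty\big)$; and $d_{\mathcal C^1}(T,\mathcal I_d)=\inf_{S\in\mathcal I_d}d_{\mathcal C^1}(T,S)$. *Renormalization.* Put $\alpha=\pi_t(d)$, $\beta=\pi_b(d)$. If $|I^t_\alpha|\ne|I^b_\beta|$, the Rauzy–Veech step $\mathcal V(T)$ is the first return map of $T$ to $[0,\ell)$, where $\ell$ is the larger of the left endpoints of $I^t_\alpha$ and $I^b_\beta$, rescaled to $[0,1)$. *Top wins* (winner $\alpha$, loser $\beta$) if $|I^t_\alpha|>|I^b_\beta|$; otherwise *bottom wins* (winner $\beta$, loser $\alpha$). In the new datum the loser is moved, in the row of which it was the last label (bottom row if top wins, top row if bottom wins), to just after the winner, and the other row is unchanged. $T$ is *infinitely renormalizable* if all $\mathcal V^n(T)$ are defined; its *rotation number* $\gamma(T)$ is the sequence of (datum, type of winner) of $\mathcal V^n(T)$, $n\ge0$,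 and $\gamma(T)$ is *irrational* if every label wins infinitely often. To a step associate the matrix $\mathrm{Id}+E_{\text{loser},\text{winner}}$. Zorich times are $N_0=0$ and $N_{k+1}=$ the first $n>N_k$ at which the type (top/bottom) of the winner differs from the type at $N_k$; $\mathcal Z^k(T)=\mathcal V^{N_k}(T)$; $Z_k$ is the product of the matrices of the steps $N_k,\dots,N_{k+1}-1$ (later ones on the left), and $Q(m,n)=Z_{n-1}\cdots Z_m$. All these matrices depend only on $\gamma(T)$. *RDC.* Let $\kappa$ be the number of classes of vertices of the $2d$-gon with top sides labelled $\pi_t(1),\dots,\pi_t(d)$ and bottom sides labelled $\pi_b(1),\dots,\pi_b(d)$ when sides with equal labels are glued by translation, and let $g=(d+1-\kappa)/2$. Write $\|A\|=\sum|A_{ij}|$ for matrices, and use Euclidean norms for vectors and operator norms for restrictions and projections. The angle $\angle(V,W)$ of two subspaces is the least angle between nonzero vectors $v\in V$, $w\in W$ (conditions on it are void if one of them is $\{0\}$). An infinitely renormalizable GIET $T$ with irrational rotation number satisfies the *Regular Diophantine Condition* (RDC) if the following hold. (i) There are splittings $\mathbb R^d=\Gamma^{(n)}_s\oplus\Gamma^{(n)}_c\oplus\Gamma^{(n)}_u$,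 $n\ge 0$, with $Q(m,n)\Gamma_a^{(m)}=\Gamma_a^{(n)}$ for $m<n$ and $\dim\Gamma_s^{(n)}=\dim\Gamma_u^{(n)}=g$, and $\theta,C>0$, such that for all $n$: $\|Q(0,n)v\|\le Ce^{-\theta n}\|v\|$ for $v\in\Gamma_s^{(0)}$, and $\|Q(0,n)^{-1}v\|\le Ce^{-\theta n}\|v\|$ for $v\in\Gamma_u^{(n)}$; moreover $\frac1n\log\|Q(0,n)v\|\to0$ for $0\ne v\in\Gamma_c^{(0)}$, and for every $\epsilon>0$ there is $c>0$ with $|\sin\angle(\Gamma_{a}^{(n)},\Gamma_{b}^{(n)})|\ge ce^{-\epsilon n}$ for all $a\neq b$ in $\{s,c,u\}$ and all $n$. (ii) There are $0=n_0<n_1<n_2<\cdots$ such that $\lim n_k/k$ exists and is finite, an integer $p>0$ and a matrix $A$ with strictly positive entries, of the form $Q(0,p)$ for some standard IET of $d$ intervals which is infinitely renormalizable with irrational rotation number, such that $Q(n_k,n_k+2p)=AA$ and $n_{k+1}-n_k\ge 2p$ for all $k\ge 1$. (iii) Writing $\widetilde Q(k,k')=Q(n_k,n_{k'})$, $\widetilde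 Z_k=\widetilde Q(k,k+1)$, $\widetilde\Gamma^{(k)}_a=\Gamma_a^{(n_k)}$, and $\widetilde P^{(k)}_a$ for the orthogonal projection to $\widetilde\Gamma_a^{(k)}$, there are $K^\pm,\delta>0$ and a strictly increasing sequence $(k_m)_{m\ge 0}$ with $\limsup k_m/m<\infty$ such that for all $m$: $$\sum_{k=1}^{k_m}\big\|\widetilde Q(k,k_m)|_{\widetilde\Gamma_s^{(k)}}\big\|\,\|\widetilde P_s^{(k)}\|\,\|\widetilde Z_{k-1}\|\le K^-,\qquad \sum_{k=k_m+1}^{\infty}\big\|\widetilde Q(k_m,k)^{-1}|_{\widetilde\Gamma_u^{(k)}}\big\|\,\|\widetilde P_u^{(k)}\|\,\|\widetilde Z_{k-1}\|\le K^+,$$ $$\angle(\widetilde\Gamma_a^{(k_m)},\widetilde\Gamma_b^{(k_m)})>\delta\ \text{ for all } a\ne b \text{ in } \{s,c,u\},\qquad\text{and}\qquad \lim_{m\to\infty}\tfrac1m\log\|\widetilde Q(k_m,k_{m+1})\|=0 .$$ **Proposition.** Let $d\ge2$ and let $T$ be a $\mathcal C^1$-GIET of $d$ intervals which satisfies the RDC.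 Assume that there are $K_1>0$ and $0<\alpha_1<1$ such that $$d_{\mathcal C^1}(\mathcal Z^n(T),\mathcal I_d)\le K_1\,\alpha_1^n\qquad\text{for all } n\in\mathbb N.$$ Then $T$ is $\mathcal C^1$-conjugate to a standard IET: there are $T_0\in\mathcal I_d$ and an orientation preserving $\mathcal C^1$-diffeomorphism $\psi$ of $[0,1]$ such that $\psi\circ T=T_0\circ\psi$ on $[0,1)$. -/

import Mathlib

open Filter Topology Set
open scoped ENNReal

noncomputable section

namespace GIETRigidity

/-! ### Combinatorial data and Rauzy moves -/

/-- A combinatorial datum `π = (π_t, π_b)` on the alphabet `Fin d`: `top p` (resp. `bot p`) is the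
label of the interval in position `p`, counted from the left, of the top (resp. bottom)
partition. -/
structure CombDatum (d : ℕ) where
  top : Equiv.Perm (Fin d)
  bot : Equiv.Perm (Fin d)

/-- Irreducibility: `π_t {1, …, k} ≠ π_b {1, …, k}` for every `1 ≤ k < d`. -/
def CombDatum.Irreducible {d : ℕ} (π : CombDatum d) : Prop :=
  ∀ k : ℕ, 1 ≤ k → k < d →
    π.top '' {p : Fin d | (p : ℕ) < k} ≠ π.bot '' {p : Fin d | (p : ℕ) < k}

/-- The type of an elementary step: which of the two last intervals (top or bottom) is the
longer one, i.e. wins. -/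
inductive WinType where
  | top
  | bot

/-- Move the last label of the ordering `σ` to the place just to the right of the label `a`. -/
def moveLastAfter {d : ℕ} [NeZero d] (σ : Equiv.Perm (Fin d)) (a : Fin d) :
    Equiv.Perm (Fin d) :=
  (Fin.cycleIcc (σ.symm a + 1) ⊤).symm.trans σ

/-- The combinatorial datum after an elementary step.  When top wins, the last bottom label is
moved just after the label `π_t(d)` in the bottom row, and symmetrically when bottom wins. -/
def CombDatum.move {d : ℕ} [NeZero d] (π : CombDatum d) : WinType → CombDatum d
  | .top => ⟨π.top, moveLastAfter π.bot (π.top ⊤)⟩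
  | .bot => ⟨moveLastAfter π.top (π.bot ⊤), π.bot⟩

/-- The vertices `U_0, …, U_d` (`Sum.inl`) and `V_0, …, V_d` (`Sum.inr`) of the suspension polygon
whose top sides are `[U_{p}, U_{p+1}]` and whose bottom sides are `[V_{p}, V_{p+1}]`, with the
identifications made when the top side and the bottom side with the same label are glued. -/
inductive CombDatum.Glued {d : ℕ} (π : CombDatum d) :
    Fin (d + 1) ⊕ Fin (d + 1) → Fin (d + 1) ⊕ Fin (d + 1) → Prop
  | first : π.Glued (.inl 0) (.inr 0)
  | last : π.Glued (.inl (Fin.last d)) (.inr (Fin.last d))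
  | left (a : Fin d) :
      π.Glued (.inl (π.top.symm a).castSucc) (.inr (π.bot.symm a).castSucc)
  | right (a : Fin d) :
      π.Glued (.inl (π.top.symm a).succ) (.inr (π.bot.symm a).succ)

/-- The number `κ` of singular points of the suspension: classes of glued vertices. -/
def CombDatum.kappa {d : ℕ} (π : CombDatum d) : ℕ := Nat.card (Quot π.Glued)

/-- The genus `g` of the suspension, given by `d = 2 g + κ - 1`. -/
def CombDatum.genus {d : ℕ} (π : CombDatum d) : ℕ := (d + 1 - π.kappa) / 2

/-! ### Generalized interval exchange transformations -/

/-- The raw data of an interval exchange on `[0, 1]`: the combinatorial datum, for each label the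
lengths of the top and bottom intervals with this label, and for each label the branch of the map
(only its values on the closure of the top interval matter). -/
structure GIETData (d : ℕ) where
  comb : CombDatum d
  lenT : Fin d → ℝ
  lenB : Fin d → ℝ
  branch : Fin d → ℝ → ℝ

/-- `f` restricts to an orientation preserving `C¹` diffeomorphism from `[a, b]` onto
`[a', b']` (one-sided derivatives at the endpoints). -/
def IsC1Diffeo (f : ℝ → ℝ) (a b a' b' : ℝ) : Prop :=
  ContDiffOn ℝ 1 f (Icc a b) ∧ (∀ x ∈ Icc a b, 0 < derivWithin f (Icc a b) x) ∧
    f a = a' ∧ f b = b'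

namespace GIETData

variable {d : ℕ}

/-- Left endpoint of the top interval with label `i`. -/
def topLeft (T : GIETData d) (i : Fin d) : ℝ :=
  ∑ j with T.comb.top.symm j < T.comb.top.symm i, T.lenT j

/-- Right endpoint of the top interval with label `i`. -/
def topRight (T : GIETData d) (i : Fin d) : ℝ := T.topLeft i + T.lenT i

/-- Left endpoint of the bottom interval with label `i`. -/
def botLeft (T : GIETData d) (i : Fin d) : ℝ :=
  ∑ j with T.comb.bot.symm j < T.comb.bot.symm i, T.lenB j

/-- Right endpoint of the bottom interval with label `i`. -/
def botRight (T : GIETData d) (i : Fin d) : ℝ := T.botLeft i + T.lenB i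

/-- `T` is a generalized interval exchange transformation of class `C¹` with irreducible
combinatorial datum. -/
structure IsC1GIET (T : GIETData d) : Prop where
  irreducible : T.comb.Irreducible
  lenT_pos : ∀ i, 0 < T.lenT i
  lenB_pos : ∀ i, 0 < T.lenB i
  sum_lenT : ∑ i, T.lenT i = 1
  sum_lenB : ∑ i, T.lenB i = 1
  diffeo : ∀ i, IsC1Diffeo (T.branch i) (T.topLeft i) (T.topRight i) (T.botLeft i) (T.botRight i)

/-- `T` is a standard interval exchange transformation. -/
def IsIET (T : GIETData d) : Prop :=
  T.IsC1GIET ∧ (∀ i, T.lenT i = T.lenB i) ∧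
    ∀ i, ∃ δ : ℝ, ∀ x ∈ Icc (T.topLeft i) (T.topRight i), T.branch i x = x + δ

/-- The map `T : [0, 1) → [0, 1)`, right-continuous at the singularities. -/
def map (T : GIETData d) (x : ℝ) : ℝ :=
  ∑ i, (Ico (T.topLeft i) (T.topRight i)).indicator (T.branch i) x

/-- `T` and `S` are conjugate by an (orientation preserving) `C¹` diffeomorphism of `[0, 1]`. -/
def C1Conjugate (T S : GIETData d) : Prop :=
  ∃ ψ : ℝ → ℝ, IsC1Diffeo ψ 0 1 0 1 ∧ ∀ x ∈ Ico (0 : ℝ) 1, ψ (T.map x) = S.map (ψ x)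

/-! ### The `C¹` distance in shape-profile coordinates -/

/-- Slope vector of the shape of `T`. -/
def slope (T : GIETData d) (i : Fin d) : ℝ := T.lenB i / T.lenT i

/-- Profile of `T`: the branches, rescaled to maps of `[0, 1]`. -/
def profile (T : GIETData d) (i : Fin d) (x : ℝ) : ℝ :=
  (T.branch i (T.topLeft i + T.lenT i * x) - T.botLeft i) / T.lenB i

/-- Euclidean distance between the parameters (length and slope vectors) of the shapes. -/
def distShape (T S : GIETData d) : ℝ :=
  Real.sqrt (∑ i, (T.lenT i - S.lenT i) ^ 2 + ∑ i, (T.slope i - S.slope i) ^ 2)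

/-- The `C¹` distance `‖φ - ψ‖_∞ + ‖φ' - ψ'‖_∞` between maps of `[0, 1]`. -/
def _root_.GIETRigidity.edistC1Fun (φ ψ : ℝ → ℝ) : ℝ≥0∞ :=
  (⨆ x ∈ Icc (0 : ℝ) 1, ENNReal.ofReal |φ x - ψ x|) +
    ⨆ x ∈ Icc (0 : ℝ) 1,
      ENNReal.ofReal |derivWithin φ (Icc 0 1) x - derivWithin ψ (Icc 0 1) x|

open Classical in
/-- The distance `d_{C¹}`: the product of the discrete distance on combinatorial data, the
Euclidean distance of the shapes and the (summed) `C¹` distance of the profiles. -/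
def edistC1 (T S : GIETData d) : ℝ≥0∞ :=
  max (if T.comb = S.comb then 0 else 1)
    (max (ENNReal.ofReal (distShape T S)) (∑ i, edistC1Fun (T.profile i) (S.profile i)))

/-- The distance `d_{C¹}(T, 𝓘_d)` to the set of standard IETs of `d` intervals. -/
def edistToIET (T : GIETData d) : ℝ≥0∞ :=
  ⨅ (S : GIETData d) (_ : S.IsIET), edistC1 T S

/-! ### Rauzy–Veech induction -/

variable [NeZero d]

/-- Top wins when the last top interval is longer than the last bottom interval. -/
def winType (T : GIETData d) : WinType :=
  if T.lenB (T.comb.bot ⊤) < T.lenT (T.comb.top ⊤) then .top else .bot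

/-- The elementary step is defined when the two last intervals have different lengths. -/
def Renormalizable (T : GIETData d) : Prop :=
  T.lenT (T.comb.top ⊤) ≠ T.lenB (T.comb.bot ⊤)

/-- The first return map of `T` to `[0, ℓ)`, where `ℓ` is the left endpoint of the last bottom
interval, when top wins.  With `α = π_t(d)`, `β = π_b(d)`: points of the top interval `β` are mapped
into `[ℓ, 1)`, which is contained in the top interval `α`, and return at time two; all the other
points of `[0, ℓ)` return at time one.  The top interval `α` is cut at `ℓ`, and the bottom
interval `α` is cut at `T_α(ℓ)`, its right part becoming the new bottom interval `β`. -/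
def inducedTop (T : GIETData d) : GIETData d :=
  let α := T.comb.top ⊤
  let β := T.comb.bot ⊤
  let ℓ := T.botLeft β
  { comb := T.comb.move .top
    lenT := Function.update T.lenT α (ℓ - T.topLeft α)
    lenB := Function.update (Function.update T.lenB α (T.branch α ℓ - T.botLeft α))
      β (T.botRight α - T.branch α ℓ)
    branch := Function.update T.branch β (T.branch α ∘ T.branch β) }

/-- The first return map of `T` to `[0, ℓ)`, where `ℓ` is the left endpoint of the last top
interval, when bottom wins.  With `α = π_t(d)`, `β = π_b(d)` and `z = T_β⁻¹(ℓ)`: points of the top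
interval `β` to the right of `z` are mapped into the top interval `α`, which is `[ℓ, 1)`, and return
at time two; they form the new top interval `α`.  All the other points of `[0, ℓ)` return at time
one.  The bottom interval `β` is cut at `ℓ`. -/
def inducedBot (T : GIETData d) : GIETData d :=
  let α := T.comb.top ⊤
  let β := T.comb.bot ⊤
  let ℓ := T.topLeft α
  let z := Function.invFunOn (T.branch β) (Icc (T.topLeft β) (T.topRight β)) ℓ
  { comb := T.comb.move .bot
    lenT := Function.update (Function.update T.lenT β (z - T.topLeft β)) α (T.topRight β - z)
    lenB := Function.update T.lenB β (ℓ - T.botLeft β)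
    branch := Function.update T.branch α (T.branch α ∘ T.branch β) }

/-- Conjugate by the affine map `[0, ℓ] → [0, 1]`. -/
def rescale (T : GIETData d) (ℓ : ℝ) : GIETData d where
  comb := T.comb
  lenT i := T.lenT i / ℓ
  lenB i := T.lenB i / ℓ
  branch i x := T.branch i (ℓ * x) / ℓ

/-- The elementary step `𝓥` of Rauzy–Veech induction: the first return map to `[0, ℓ)`, where `ℓ` is
the larger of the left endpoints of the last top interval and of the last bottom interval, rescaled
to `[0, 1)`.  Meaningful on `C¹` GIETs which are `Renormalizable`. -/
def rauzyVeech (T : GIETData d) : GIETData d :=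
  match T.winType with
  | .top => T.inducedTop.rescale (T.botLeft (T.comb.bot ⊤))
  | .bot => T.inducedBot.rescale (T.topLeft (T.comb.top ⊤))

/-- `𝓥ⁿ(T)` is defined for all `n`. -/
def InfinitelyRenormalizable (T : GIETData d) : Prop :=
  ∀ n : ℕ, (rauzyVeech^[n] T).Renormalizable

end GIETData

/-! ### Rotation numbers and the Zorich cocycle -/

/-- An arrow of the Rauzy diagram, from the vertex `source` to `source.move type`. -/
structure RauzyArrow (d : ℕ) where
  source : CombDatum d
  type : WinType

section Arrow

variable {d : ℕ} [NeZero d]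

/-- The label of the longer of the two last intervals. -/
def RauzyArrow.winner (a : RauzyArrow d) : Fin d :=
  match a.type with
  | .top => a.source.top ⊤
  | .bot => a.source.bot ⊤

/-- The label of the shorter of the two last intervals. -/
def RauzyArrow.loser (a : RauzyArrow d) : Fin d :=
  match a.type with
  | .top => a.source.bot ⊤
  | .bot => a.source.top ⊤

/-- The matrix by which the vector of return times changes in an elementary step: the identity plus
the elementary matrix with entry one in the row of the loser and the column of the winner. -/
def RauzyArrow.matrix (a : RauzyArrow d) : Matrix (Fin d) (Fin d) ℝ :=
  1 + Matrix.single a.loser a.winner 1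

/-- The combinatorial rotation number `γ(T)`: the sequence of arrows followed by the orbit of `T`
under Rauzy–Veech induction. -/
def GIETData.rotationNumber (T : GIETData d) (n : ℕ) : RauzyArrow d :=
  ⟨(GIETData.rauzyVeech^[n] T).comb, (GIETData.rauzyVeech^[n] T).winType⟩

/-- Irrational (`∞`-complete) paths: every label wins infinitely often. -/
def InfinityComplete (γ : ℕ → RauzyArrow d) : Prop :=
  ∀ j : Fin d, ∃ᶠ n in atTop, (γ n).winner = j

/-- Infinitely renormalizable, with irrational rotation number. -/
def GIETData.Irrational (T : GIETData d) : Prop :=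
  T.InfinitelyRenormalizable ∧ InfinityComplete T.rotationNumber

/-- The times of the Zorich acceleration: `0`, and then successively the first later time at which
the type of the elementary step is different. -/
def zorichTime (γ : ℕ → RauzyArrow d) : ℕ → ℕ
  | 0 => 0
  | k + 1 => sInf {n | zorichTime γ k < n ∧ (γ n).type ≠ (γ (zorichTime γ k)).type}

/-- The Zorich renormalizations `𝓩ᵏ(T)`. -/
def GIETData.zorich (T : GIETData d) (k : ℕ) : GIETData d :=
  GIETData.rauzyVeech^[zorichTime T.rotationNumber k] T

/-- The product `M (m + l - 1) * ⋯ * M (m + 1) * M m` of `l` factors. -/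
def prodFrom (M : ℕ → Matrix (Fin d) (Fin d) ℝ) (m : ℕ) : ℕ → Matrix (Fin d) (Fin d) ℝ
  | 0 => 1
  | l + 1 => M (m + l) * prodFrom M m l

/-- The matrices `Z_k` of the Zorich cocycle: the product of the matrices of the elementary steps
that are grouped in the `k`-th Zorich step. -/
def zorichMatrix (γ : ℕ → RauzyArrow d) (k : ℕ) : Matrix (Fin d) (Fin d) ℝ :=
  prodFrom (fun n => (γ n).matrix) (zorichTime γ k) (zorichTime γ (k + 1) - zorichTime γ k)

/-- `Q(m, n) = Z_{n-1} ⋯ Z_{m+1} Z_m`. -/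
def zorichQ (γ : ℕ → RauzyArrow d) (m n : ℕ) : Matrix (Fin d) (Fin d) ℝ :=
  prodFrom (zorichMatrix γ) m (n - m)

end Arrow

/-! ### The Regular Diophantine Condition -/

section RDC

variable {d : ℕ}

/-- The linear map of Euclidean `ℝ^d` given by a matrix. -/
abbrev toLin (A : Matrix (Fin d) (Fin d) ℝ) :
    EuclideanSpace ℝ (Fin d) →L[ℝ] EuclideanSpace ℝ (Fin d) :=
  Matrix.toEuclideanCLM (n := Fin d) (𝕜 := ℝ) A

/-- The norm `∑ |A_{ij}|`. -/
def entryNorm (A : Matrix (Fin d) (Fin d) ℝ) : ℝ := ∑ i, ∑ j, |A i j|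

/-- Operator norm of the restriction of `A` to the subspace `Γ`. -/
def restrictNorm (A : Matrix (Fin d) (Fin d) ℝ)
    (Γ : Submodule ℝ (EuclideanSpace ℝ (Fin d))) : ℝ :=
  ‖(toLin A).comp Γ.subtypeL‖

/-- Labels of the stable, central and unstable spaces. -/
inductive Osel where
  | s
  | c
  | u

variable [NeZero d]

/-- `Γ` is a sequence of invariant splittings showing that the rotation number `γ` has an Oseledets
generic extension.  The conditions on the angle between two subspaces, i.e. the smallest angle
between nonzero vectors of them, are written for all pairs of nonzero vectors. -/
structure IsOseledetsSplitting (γ : ℕ → RauzyArrow d)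
    (Γ : Osel → ℕ → Submodule ℝ (EuclideanSpace ℝ (Fin d))) : Prop where
  indep : ∀ n, iSupIndep fun a => Γ a n
  span : ∀ n, ⨆ a, Γ a n = ⊤
  invariant : ∀ a m n, m < n →
    (Γ a m).map (toLin (zorichQ γ m n) : EuclideanSpace ℝ (Fin d) →ₗ[ℝ] _) = Γ a n
  finrank_s : ∀ n, Module.finrank ℝ (Γ .s n) = (γ 0).source.genus
  finrank_u : ∀ n, Module.finrank ℝ (Γ .u n) = (γ 0).source.genus
  hyperbolic : ∃ θ > 0, ∃ C > 0,
    (∀ n, ∀ v ∈ Γ .s 0, ‖toLin (zorichQ γ 0 n) v‖ ≤ C * Real.exp (-θ * n) * ‖v‖) ∧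
    (∀ n, ∀ v ∈ Γ .u n, ‖toLin (zorichQ γ 0 n)⁻¹ v‖ ≤ C * Real.exp (-θ * n) * ‖v‖)
  central : ∀ v ∈ Γ .c 0, v ≠ 0 →
    Tendsto (fun n : ℕ => Real.log ‖toLin (zorichQ γ 0 n) v‖ / n) atTop (𝓝 0)
  angles : ∀ ε > 0, ∃ c > 0, ∀ n : ℕ, ∀ a₁ a₂, a₁ ≠ a₂ →
    ∀ v ∈ Γ a₁ n, ∀ w ∈ Γ a₂ n, v ≠ 0 → w ≠ 0 →
      c * Real.exp (-ε * n) ≤ Real.sin (InnerProductGeometry.angle v w)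

/-- `A` is a positive matrix which is a product of `p` matrices of the Zorich cocycle, i.e.
`A = Q(0, p)` for some standard IET. -/
def IsPositiveZorichMatrix (p : ℕ) (A : Matrix (Fin d) (Fin d) ℝ) : Prop :=
  (∀ i j, 0 < A i j) ∧
    ∃ S : GIETData d, S.IsIET ∧ S.Irrational ∧ A = zorichQ S.rotationNumber 0 p

/-- `n₁ < n₂ < ⋯` are good return times, with the convention `n₀ = 0`. -/
def IsGoodReturns (γ : ℕ → RauzyArrow d) (n : ℕ → ℕ) : Prop :=
  n 0 = 0 ∧ StrictMono n ∧
    ∃ p > 0, ∃ A : Matrix (Fin d) (Fin d) ℝ, IsPositiveZorichMatrix p A ∧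
      ∀ k ≥ 1, zorichQ γ (n k) (n k + 2 * p) = A * A ∧ 2 * p ≤ n (k + 1) - n k

/-- The Regular Diophantine Condition for a rotation number. -/
def RDC (γ : ℕ → RauzyArrow d) : Prop :=
  ∃ Γ : Osel → ℕ → Submodule ℝ (EuclideanSpace ℝ (Fin d)), IsOseledetsSplitting γ Γ ∧
  ∃ n : ℕ → ℕ, IsGoodReturns γ n ∧
    (∃ L : ℝ, Tendsto (fun k : ℕ => (n k : ℝ) / k) atTop (𝓝 L)) ∧
  ∃ κ : ℕ → ℕ, StrictMono κ ∧
    (∃ C : ℝ, ∀ᶠ m : ℕ in atTop, (κ m : ℝ) / m ≤ C) ∧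
    -- Condition [B]
    (∃ K > 0, ∀ m, ∑ k ∈ Finset.Icc 1 (κ m),
      restrictNorm (zorichQ γ (n k) (n (κ m))) (Γ .s (n k)) *
        ‖(Γ .s (n k)).starProjection‖ * entryNorm (zorichQ γ (n (k - 1)) (n k)) ≤ K) ∧
    -- Condition [F]: the partial sums of the series of nonnegative terms are bounded
    (∃ K > 0, ∀ m N, ∑ k ∈ Finset.Icc (κ m + 1) N,
      restrictNorm (zorichQ γ (n (κ m)) (n k))⁻¹ (Γ .u (n k)) *
        ‖(Γ .u (n k)).starProjection‖ * entryNorm (zorichQ γ (n (k - 1)) (n k)) ≤ K) ∧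
    -- Condition [S]
    Tendsto (fun m : ℕ => Real.log (entryNorm (zorichQ γ (n (κ m)) (n (κ (m + 1))))) / m)
      atTop (𝓝 0) ∧
    -- Condition [A]
    (∃ δ > 0, ∀ m, ∀ a₁ a₂, a₁ ≠ a₂ →
      ∀ v ∈ Γ a₁ (n (κ m)), ∀ w ∈ Γ a₂ (n (κ m)), v ≠ 0 → w ≠ 0 →
        δ < InnerProductGeometry.angle v w)

/-- A GIET satisfies the Regular Diophantine Condition when it is infinitely renormalizable with
irrational rotation number and its rotation number satisfies the condition. -/
def GIETData.SatisfiesRDC (T : GIETData d) : Prop :=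
  T.Irrational ∧ RDC T.rotationNumber

end RDC

end GIETRigidity

end

/-! A continuous solution `φ` of the cohomological equation `φ ∘ T + log DT = φ` gives the
conjugacy. The normalized primitive `ψ` of `exp φ` has `(ψ ∘ T)' = ψ'` on every branch, so `ψ` turns
each branch into a translation (`IsC1GIET.exists_c1Conjugate`).

The equation is solved through renormalization. Let `[0, l)` be the interval of induction. A
solution for the renormalized map, rescaled to `[0, l)`, extends to `[0, 1)`: a point `x ≥ l` lies
in the last top interval and is mapped into `[0, l)` by its branch, so the equation prescribes the
value at `x`. The extension solves the equation for `T`, and an error in the equation does not grow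
(`CohomErr.lift`). Iterating formally gives the series `transfer`, whose `n`-th term is at most the
supremum of `|log D|` for the `n`-th Rauzy–Veech renormalization. Its terms need not be continuous,
so continuity has to come from the dynamics. The oscillation of a solution at a point is at most
that of the renormalized solution at a suitable point (`oscLE_lift`). If the suprema are summable,
the transfer function of the `n`-th renormalization is bounded by a tail of the series. Its error
and its oscillation are then small, and both bounds descend to `T` unchanged; letting `n → ∞` gives
an exact solution with zero oscillation.

It remains to sum the suprema (`summable_slopeSup`). At Zorich times they decay exponentially, since
a map that is `C¹`-close to a standard IET has small logarithmic slopes. Within a Zorich block the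
winner and its branch do not change, apart from restriction and rescaling, and each step composes
one other branch with it. The bound therefore grows linearly, and a block of length `L` contributes
at most `L²` times its initial supremum. The length is bounded by the norm of the cocycle
(`prodFrom_matrix_ge`), which Condition [S] makes subexponential in the Zorich time, so the
exponential decay wins. -/

noncomputable section

namespace GIETRigidity

/-! ### Positions and left endpoints -/

section LeftSum

variable {d : ℕ}

/-- Left endpoint of the interval with label `i` in a row ordered by `σ` with lengths `len`. -/
def leftSum (σ : Equiv.Perm (Fin d)) (len : Fin d → ℝ) (i : Fin d) : ℝ :=
  ∑ j with σ.symm j < σ.symm i, len j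

lemma leftSum_nonneg (σ : Equiv.Perm (Fin d)) {len : Fin d → ℝ} (h : ∀ i, 0 ≤ len i)
    (i : Fin d) : 0 ≤ leftSum σ len i :=
  Finset.sum_nonneg fun j _ => h j

lemma leftSum_add_eq_sum_le (σ : Equiv.Perm (Fin d)) (len : Fin d → ℝ) (i : Fin d) :
    leftSum σ len i + len i = ∑ j with σ.symm j ≤ σ.symm i, len j := by
  have : (Finset.univ.filter fun j => σ.symm j ≤ σ.symm i)
      = insert i (Finset.univ.filter fun j => σ.symm j < σ.symm i) := by
    ext j
    simp only [Finset.mem_filter, Finset.mem_univ, true_and, Finset.mem_insert, le_iff_eq_or_lt,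
      EmbeddingLike.apply_eq_iff_eq]
  rw [this, Finset.sum_insert (by simp), add_comm, leftSum]

lemma leftSum_add_le (σ : Equiv.Perm (Fin d)) {len : Fin d → ℝ} (h : ∀ i, 0 ≤ len i)
    {i j : Fin d} (hij : σ.symm i < σ.symm j) : leftSum σ len i + len i ≤ leftSum σ len j := by
  rw [leftSum_add_eq_sum_le]
  refine Finset.sum_le_sum_of_subset_of_nonneg (fun k hk => ?_) fun k _ _ => h k
  simp only [Finset.mem_filter, Finset.mem_univ, true_and] at hk ⊢
  exact hk.trans_lt hij

lemma leftSum_add_le_sum (σ : Equiv.Perm (Fin d)) {len : Fin d → ℝ} (h : ∀ i, 0 ≤ len i)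
    (i : Fin d) : leftSum σ len i + len i ≤ ∑ j, len j := by
  rw [leftSum_add_eq_sum_le]
  exact Finset.sum_le_sum_of_subset_of_nonneg (Finset.subset_univ _) fun k _ _ => h k

lemma leftSum_eq_sum_ite (σ : Equiv.Perm (Fin d)) (len : Fin d → ℝ) (i : Fin d) :
    leftSum σ len i = ∑ j, if σ.symm j < σ.symm i then len j else 0 := by
  rw [leftSum, Finset.sum_filter]

/-- Telescoping: images of consecutive intervals under a map add up. -/
lemma leftSum_telescope (σ : Equiv.Perm (Fin d)) (len : Fin d → ℝ) (F : ℝ → ℝ) (hF : F 0 = 0)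
    (i : Fin d) :
    leftSum σ (fun j => F (leftSum σ len j + len j) - F (leftSum σ len j)) i
      = F (leftSum σ len i) := by
  obtain ⟨p, rfl⟩ := σ.surjective i
  obtain ⟨k, hk⟩ := p
  induction k with
  | zero =>
    have h0 : ∀ j : Fin d, ¬ σ.symm j < ⟨0, hk⟩ := fun j hj => by
      simp [Fin.lt_def] at hj
    simp [leftSum, h0, hF]
  | succ k ih =>
    have hk' : k < d := by omega
    have key : ∀ l : Fin d → ℝ, leftSum σ l (σ ⟨k + 1, hk⟩)
        = leftSum σ l (σ ⟨k, hk'⟩) + l (σ ⟨k, hk'⟩) := fun l => by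
      rw [leftSum_add_eq_sum_le, leftSum]
      congr 1
      ext j
      simp [Fin.lt_def, Fin.le_def]
    rw [key, key len, ih hk']
    ring

lemma sum_telescope (σ : Equiv.Perm (Fin d)) (len : Fin d → ℝ) (F : ℝ → ℝ) (hF : F 0 = 0) :
    ∑ j, (F (leftSum σ len j + len j) - F (leftSum σ len j)) = F (∑ j, len j) := by
  rcases d with _ | d
  · simp [hF]
  have key : ∀ l : Fin (d + 1) → ℝ,
      ∑ j, l j = leftSum σ l (σ (Fin.last d)) + l (σ (Fin.last d)) := fun l => by
    rw [leftSum_add_eq_sum_le]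
    congr 1
    ext j
    simp [Fin.le_last]
  rw [key, leftSum_telescope σ len F hF, key len]
  ring

/-- If no interval contained `x`, induction on the position would put every right endpoint at or
below `x`, and the last one is the total length. No sign condition on the lengths is needed. -/
lemma exists_mem_Ico_leftSum (σ : Equiv.Perm (Fin d)) (len : Fin d → ℝ) {x : ℝ} (h0 : 0 ≤ x)
    (h1 : x < ∑ j, len j) : ∃ i, x ∈ Ico (leftSum σ len i) (leftSum σ len i + len i) := by
  by_contra! hcon
  have hd : d ≠ 0 := by
    rintro rfl
    simp at h1
    linarith
  have key : ∀ k (hk : k < d), leftSum σ len (σ ⟨k, hk⟩) + len (σ ⟨k, hk⟩) ≤ x := by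
    intro k
    induction k with
    | zero =>
      intro hk
      have h00 : leftSum σ len (σ ⟨0, hk⟩) = 0 := by
        simp [leftSum, Fin.lt_def]
      have := hcon (σ ⟨0, hk⟩)
      rw [mem_Ico, not_and, not_lt, h00] at this
      rw [h00]
      exact this h0
    | succ k ih =>
      intro hk
      have hs : leftSum σ len (σ ⟨k + 1, hk⟩)
          = leftSum σ len (σ ⟨k, by omega⟩) + len (σ ⟨k, by omega⟩) := by
        rw [leftSum_add_eq_sum_le, leftSum]
        congr 1
        ext j
        simp [Fin.lt_def, Fin.le_def]
      have := hcon (σ ⟨k + 1, hk⟩)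
      rw [mem_Ico, not_and, not_lt] at this
      exact this (hs ▸ ih (by omega))
  have := key (d - 1) (by omega)
  rw [leftSum_add_eq_sum_le] at this
  have hu : (Finset.univ.filter fun j => σ.symm j ≤ σ.symm (σ ⟨d - 1, by omega⟩))
      = Finset.univ := by
    ext j
    simp [Fin.le_def]
    omega
  rw [hu] at this
  linarith

lemma eq_of_mem_Ico_leftSum (σ : Equiv.Perm (Fin d)) {len : Fin d → ℝ} (h : ∀ i, 0 ≤ len i)
    {x : ℝ} {i j : Fin d} (hi : x ∈ Ico (leftSum σ len i) (leftSum σ len i + len i))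
    (hj : x ∈ Ico (leftSum σ len j) (leftSum σ len j + len j)) : i = j := by
  rcases lt_trichotomy (σ.symm i) (σ.symm j) with hij | hij | hij
  · linarith [leftSum_add_le σ h hij, hi.2, hj.1]
  · exact σ.symm.injective hij
  · linarith [leftSum_add_le σ h hij, hj.2, hi.1]

/-- Bookkeeping for a cut: an elementary step redistributes length between two labels and leaves the
others alone. -/
lemma sum_congr_pair {F G : Fin d → ℝ} {a b : Fin d} (hab : a ≠ b) (h : F a + F b = G a + G b)
    (h' : ∀ j, j ≠ a → j ≠ b → F j = G j) : ∑ j, F j = ∑ j, G j := by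
  have key : ∀ H : Fin d → ℝ, ∑ j, H j = H a + H b + ∑ j ∈ (Finset.univ.erase a).erase b, H j :=
    fun H => by
      rw [← Finset.add_sum_erase _ _ (Finset.mem_univ a),
        ← Finset.add_sum_erase (Finset.univ.erase a) _ (by simpa using hab.symm : b ∈ _), add_assoc]
  rw [key F, key G, h]
  congr 1
  refine Finset.sum_congr rfl fun j hj => ?_
  simp only [Finset.mem_erase, Finset.mem_univ, and_true] at hj
  exact h' j hj.2 hj.1

lemma image_lt_eq_iff (σ τ : Equiv.Perm (Fin d)) (k : ℕ) :
    σ '' {p : Fin d | (p : ℕ) < k} = τ '' {p : Fin d | (p : ℕ) < k} ↔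
      ∀ j, (σ.symm j : ℕ) < k ↔ (τ.symm j : ℕ) < k := by
  simp [Set.ext_iff, Equiv.image_eq_preimage_symm]

/-! ### The last label of a row, and the Rauzy move on positions and left endpoints. -/

variable [NeZero d]

lemma symm_lt_top (σ : Equiv.Perm (Fin d)) {i : Fin d} (h : i ≠ σ ⊤) : σ.symm i < ⊤ :=
  lt_top_iff_ne_top.2 fun h' => h (by rw [← h', Equiv.apply_symm_apply])

lemma leftSum_top_add (σ : Equiv.Perm (Fin d)) (len : Fin d → ℝ) :
    leftSum σ len (σ ⊤) + len (σ ⊤) = ∑ j, len j := by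
  rw [leftSum_add_eq_sum_le]
  simp

lemma leftSum_add_le_top (σ : Equiv.Perm (Fin d)) {len : Fin d → ℝ} (h : ∀ i, 0 ≤ len i)
    {i : Fin d} (hi : i ≠ σ ⊤) : leftSum σ len i + len i ≤ leftSum σ len (σ ⊤) :=
  leftSum_add_le σ h (by simpa using symm_lt_top σ hi)

lemma leftSum_congr_of_ne_top (σ : Equiv.Perm (Fin d)) {len len' : Fin d → ℝ}
    (h : ∀ j, j ≠ σ ⊤ → len' j = len j) (i : Fin d) : leftSum σ len' i = leftSum σ len i := by
  refine Finset.sum_congr rfl fun j hj => h j ?_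
  rintro rfl
  simp at hj

lemma val_top_fin : ((⊤ : Fin d) : ℕ) = d - 1 := by
  have h : ∀ k : ℕ, ∀ _ : NeZero k, ((⊤ : Fin k) : ℕ) = k - 1 := by
    rintro (_ | k) h
    · exact absurd rfl h.out
    · rfl
  exact h d _

lemma val_moveLastAfter_symm (σ : Equiv.Perm (Fin d)) {a : Fin d} (ha : a ≠ σ ⊤) (j : Fin d) :
    (((moveLastAfter σ a).symm j : Fin d) : ℕ) =
      if j = σ ⊤ then (σ.symm a : ℕ) + 1
      else if (σ.symm j : ℕ) ≤ σ.symm a then (σ.symm j : ℕ) else (σ.symm j : ℕ) + 1 := by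
  have hlt := symm_lt_top σ ha
  have hlt' : (σ.symm a : ℕ) < d - 1 := by rw [← val_top_fin]; exact hlt
  have hsucc : ∀ p : Fin d, (p : ℕ) < d - 1 → ((p + 1 : Fin d) : ℕ) = p + 1 := fun p hp => by
    rw [Fin.val_add_one_of_lt']
    omega
  have hE : (moveLastAfter σ a).symm j = Fin.cycleIcc (σ.symm a + 1) ⊤ (σ.symm j) := rfl
  rw [hE]
  split_ifs with h1 h2
  · subst h1
    rw [Equiv.symm_apply_apply, Fin.cycleIcc_of_last le_top, hsucc _ hlt']
  · rw [Fin.cycleIcc_of_lt]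
    rw [Fin.lt_def, hsucc _ hlt']
    omega
  · have h3 := symm_lt_top σ h1
    rw [Fin.cycleIcc_of_ge_of_lt ?_ h3, hsucc]
    · rw [← val_top_fin]; exact h3
    · rw [Fin.le_def, hsucc _ hlt']
      omega

/-- The old interval `a` is split into the new `a` followed by the moved label, so every other
interval has the same total length to its left as before. -/
lemma leftSum_moveLastAfter (σ : Equiv.Perm (Fin d)) {a : Fin d} (ha : a ≠ σ ⊤)
    {len len' : Fin d → ℝ} (hsum : len' a + len' (σ ⊤) = len a)
    (h : ∀ j, j ≠ a → j ≠ σ ⊤ → len' j = len j) {i : Fin d} (hi : i ≠ σ ⊤) :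
    leftSum (moveLastAfter σ a) len' i = leftSum σ len i := by
  rw [leftSum_eq_sum_ite, leftSum_eq_sum_ite]
  have hpi := symm_lt_top σ hi
  have hinj : σ.symm i = σ.symm a → i = a := fun h => σ.symm.injective h
  refine sum_congr_pair ha ?_ fun j hja hjb => ?_
  · simp only [Fin.lt_def, val_moveLastAfter_symm σ ha, if_neg ha, if_neg hi, if_true, le_refl,
      Equiv.symm_apply_apply] at hpi ⊢
    rw [← hsum]
    split_ifs <;> first | omega | simp
  · simp only [Fin.lt_def, val_moveLastAfter_symm σ ha, if_neg hjb, if_neg hi]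
    rw [h j hja hjb]
    congr 1
    apply propext
    split_ifs <;> omega

lemma leftSum_moveLastAfter_last (σ : Equiv.Perm (Fin d)) {a : Fin d} (ha : a ≠ σ ⊤)
    {len len' : Fin d → ℝ} (h : ∀ j, j ≠ a → j ≠ σ ⊤ → len' j = len j) :
    leftSum (moveLastAfter σ a) len' (σ ⊤) = leftSum σ len a + len' a := by
  have hu : leftSum σ len a + len' a = leftSum σ (Function.update len a (len' a)) a
      + Function.update len a (len' a) a := by
    congr 1
    · refine Finset.sum_congr rfl fun j hj => ?_
      rw [Function.update_of_ne]
      rintro rfl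
      simp at hj
    · simp
  rw [hu, leftSum_add_eq_sum_le, leftSum, Finset.sum_filter, Finset.sum_filter]
  have hpa := symm_lt_top σ ha
  refine sum_congr_pair ha ?_ fun j hja hjb => ?_
  · simp only [Fin.lt_def, Fin.le_def, val_moveLastAfter_symm σ ha, if_neg ha, if_true, le_refl,
      Equiv.symm_apply_apply] at hpa ⊢
    have htop := val_top_fin (d := d)
    simp only [Function.update_self, if_true, Nat.lt_succ_self, lt_irrefl, if_false,
      add_zero, not_le.2 hpa]
  · simp only [Fin.lt_def, Fin.le_def, val_moveLastAfter_symm σ ha, if_neg hjb, if_true]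
    rw [h j hja hjb, Function.update_of_ne hja]
    congr 1
    apply propext
    split_ifs <;> omega

/-- Since `τ ⊤` is last for `τ` and `k < d`, it is not among the first `k` labels of `τ`, hence not
among those of the moved row. Everything the move displaces lies to its right, so the first `k`
labels of `σ` are untouched. This is why irreducibility survives a step. -/
lemma image_moveLastAfter (σ τ : Equiv.Perm (Fin d)) (h : τ ⊤ ≠ σ ⊤) {k : ℕ} (hk : k < d)
    (he : moveLastAfter σ (τ ⊤) '' {p : Fin d | (p : ℕ) < k} = τ '' {p : Fin d | (p : ℕ) < k}) :
    σ '' {p : Fin d | (p : ℕ) < k} = τ '' {p : Fin d | (p : ℕ) < k} := by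
  rw [image_lt_eq_iff] at he ⊢
  intro j
  rw [← he j]
  have ha := he (τ ⊤)
  have htop := val_top_fin (d := d)
  rw [val_moveLastAfter_symm σ h, if_neg h, if_pos le_rfl, Equiv.symm_apply_apply] at ha
  rw [val_moveLastAfter_symm σ h]
  split_ifs with h1 h2
  · subst h1
    rw [Equiv.symm_apply_apply]
    omega
  · rfl
  · omega

lemma CombDatum.Irreducible.top_ne_bot {π : CombDatum d} (h : π.Irreducible) (hd : 2 ≤ d) :
    π.top ⊤ ≠ π.bot ⊤ := by
  intro he
  refine h (d - 1) (by omega) (by omega) ((image_lt_eq_iff _ _ _).2 fun j => ?_)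
  have key : ∀ σ : Equiv.Perm (Fin d), (σ.symm j : ℕ) < d - 1 ↔ j ≠ σ ⊤ := fun σ => by
    rw [← val_top_fin, ← Fin.lt_def, lt_top_iff_ne_top, Ne, Equiv.symm_apply_eq]
  rw [key, key, he]

lemma CombDatum.Irreducible.move {π : CombDatum d} (h : π.Irreducible) (hd : 2 ≤ d) (w : WinType) :
    (π.move w).Irreducible := by
  intro k hk hkd he
  have hne := h.top_ne_bot hd
  cases w with
  | top => exact h k hk hkd (image_moveLastAfter π.bot π.top hne hkd he.symm).symm
  | bot => exact h k hk hkd (image_moveLastAfter π.top π.bot hne.symm hkd he)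

end LeftSum

/-! ### `C¹` diffeomorphisms of intervals -/

namespace IsC1Diffeo

variable {f g : ℝ → ℝ} {a b a' b' a'' b'' : ℝ}

lemma hasDerivWithinAt (h : IsC1Diffeo f a b a' b') {x : ℝ} (hx : x ∈ Icc a b) :
    HasDerivWithinAt f (derivWithin f (Icc a b) x) (Icc a b) x :=
  (h.1.differentiableOn one_ne_zero x hx).hasDerivWithinAt

lemma continuousOn (h : IsC1Diffeo f a b a' b') : ContinuousOn f (Icc a b) := h.1.continuousOn

lemma continuousOn_derivWithin (h : IsC1Diffeo f a b a' b') (hab : a < b) :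
    ContinuousOn (derivWithin f (Icc a b)) (Icc a b) :=
  h.1.continuousOn_derivWithin (uniqueDiffOn_Icc hab) le_rfl

lemma strictMonoOn (h : IsC1Diffeo f a b a' b') : StrictMonoOn f (Icc a b) := by
  refine strictMonoOn_of_deriv_pos (convex_Icc a b) h.continuousOn fun x hx => ?_
  rw [interior_Icc] at hx
  rw [← derivWithin_of_mem_nhds (Icc_mem_nhds hx.1 hx.2)]
  exact h.2.1 x (Ioo_subset_Icc_self hx)

lemma mapsTo_Icc (h : IsC1Diffeo f a b a' b') : MapsTo f (Icc a b) (Icc a' b') := fun x hx => by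
  have hab := hx.1.trans hx.2
  rw [← h.2.2.1, ← h.2.2.2]
  exact ⟨h.strictMonoOn.monotoneOn (left_mem_Icc.2 hab) hx hx.1,
    h.strictMonoOn.monotoneOn hx (right_mem_Icc.2 hab) hx.2⟩

lemma lt_right (h : IsC1Diffeo f a b a' b') {x : ℝ} (hx : x ∈ Ico a b) : f x < b' := by
  rw [← h.2.2.2]
  exact h.strictMonoOn ⟨hx.1, hx.2.le⟩ (right_mem_Icc.2 (hx.1.trans hx.2.le)) hx.2

lemma left_lt (h : IsC1Diffeo f a b a' b') {x : ℝ} (hx : x ∈ Ioc a b) : a' < f x := by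
  rw [← h.2.2.1]
  exact h.strictMonoOn (left_mem_Icc.2 (hx.1.le.trans hx.2)) ⟨hx.1.le, hx.2⟩ hx.1

lemma mapsTo_Ico (h : IsC1Diffeo f a b a' b') : MapsTo f (Ico a b) (Ico a' b') := fun _ hx =>
  ⟨(h.mapsTo_Icc (Ico_subset_Icc_self hx)).1, h.lt_right hx⟩

lemma derivWithin_subset (h : IsC1Diffeo f a b a' b') {c e x : ℝ} (hce : c < e)
    (hs : Icc c e ⊆ Icc a b) (hx : x ∈ Icc c e) :
    derivWithin f (Icc c e) x = derivWithin f (Icc a b) x :=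
  ((h.hasDerivWithinAt (hs hx)).mono hs).derivWithin (uniqueDiffOn_Icc hce x hx)

lemma restrict (h : IsC1Diffeo f a b a' b') {c e : ℝ} (hac : a ≤ c) (hce : c < e) (heb : e ≤ b) :
    IsC1Diffeo f c e (f c) (f e) :=
  have hs : Icc c e ⊆ Icc a b := Icc_subset_Icc hac heb
  ⟨h.1.mono hs, fun x hx => by rw [h.derivWithin_subset hce hs hx]; exact h.2.1 x (hs hx), rfl, rfl⟩

lemma derivWithin_comp (hg : IsC1Diffeo g a' b' a'' b'') (hf : IsC1Diffeo f a b a' b')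
    (hab : a < b) {x : ℝ} (hx : x ∈ Icc a b) :
    derivWithin (g ∘ f) (Icc a b) x
      = derivWithin g (Icc a' b') (f x) * derivWithin f (Icc a b) x :=
  ((hg.hasDerivWithinAt (hf.mapsTo_Icc hx)).comp x (hf.hasDerivWithinAt hx)
    hf.mapsTo_Icc).derivWithin (uniqueDiffOn_Icc hab x hx)

lemma comp (hg : IsC1Diffeo g a' b' a'' b'') (hf : IsC1Diffeo f a b a' b') (hab : a < b) :
    IsC1Diffeo (g ∘ f) a b a'' b'' := by
  refine ⟨hg.1.comp hf.1 hf.mapsTo_Icc, fun x hx => ?_, ?_, ?_⟩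
  · rw [derivWithin_comp hg hf hab hx]
    exact mul_pos (hg.2.1 _ (hf.mapsTo_Icc hx)) (hf.2.1 x hx)
  · rw [Function.comp_apply, hf.2.2.1, hg.2.2.1]
  · rw [Function.comp_apply, hf.2.2.2, hg.2.2.2]

lemma mul_mem_Icc_of_mem_div {l x : ℝ} (hl : 0 < l) (hx : x ∈ Icc (a / l) (b / l)) :
    l * x ∈ Icc a b := by
  rw [mem_Icc, div_le_iff₀ hl, le_div_iff₀ hl] at hx
  rw [mul_comm]
  exact hx

lemma derivWithin_rescale (h : IsC1Diffeo f a b a' b') (hab : a < b) {l x : ℝ} (hl : 0 < l)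
    (hx : x ∈ Icc (a / l) (b / l)) :
    derivWithin (fun x => f (l * x) / l) (Icc (a / l) (b / l)) x
      = derivWithin f (Icc a b) (l * x) := by
  have h1 : HasDerivWithinAt (fun x => l * x) l (Icc (a / l) (b / l)) x := by
    simpa using (hasDerivWithinAt_id x (Icc (a / l) (b / l))).const_mul l
  have h2 := ((h.hasDerivWithinAt (mul_mem_Icc_of_mem_div hl hx)).comp x h1
    fun y hy => mul_mem_Icc_of_mem_div hl hy).div_const l
  rw [mul_div_cancel_right₀ _ hl.ne'] at h2
  exact h2.derivWithin (uniqueDiffOn_Icc (div_lt_div_of_pos_right hab hl) x hx)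

lemma rescale (h : IsC1Diffeo f a b a' b') (hab : a < b) {l : ℝ} (hl : 0 < l) :
    IsC1Diffeo (fun x => f (l * x) / l) (a / l) (b / l) (a' / l) (b' / l) := by
  refine ⟨?_, fun x hx => ?_, ?_, ?_⟩
  · exact (h.1.comp (contDiff_const.mul contDiff_id).contDiffOn
      fun y hy => mul_mem_Icc_of_mem_div hl hy).div_const l
  · rw [h.derivWithin_rescale hab hl hx]
    exact h.2.1 _ (mul_mem_Icc_of_mem_div hl hx)
  · simp only [mul_div_cancel₀ _ hl.ne', h.2.2.1]
  · simp only [mul_div_cancel₀ _ hl.ne', h.2.2.2]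

/-- Inverse image of an interior point. -/
lemma exists_preimage (h : IsC1Diffeo f a b a' b') (hab : a ≤ b) {y : ℝ} (hy : y ∈ Ioo a' b') :
    ∃ x ∈ Ioo a b, f x = y := by
  rw [← h.2.2.1, ← h.2.2.2] at hy
  exact intermediate_value_Ioo hab h.continuousOn hy

/-- Openness at interior points, from the inverse function theorem; it transports oscillation bounds
forward along a branch. -/
lemma nhds_le_map (h : IsC1Diffeo f a b a' b') {x : ℝ} (hx : x ∈ Ioo a b) :
    𝓝 (f x) ≤ map f (𝓝 x) := by
  have hn := Icc_mem_nhds hx.1 hx.2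
  have hx' := Ioo_subset_Icc_self hx
  have hc : ContDiffAt ℝ 1 f x := h.1.contDiffAt hn
  have hs := hc.hasStrictDerivAt one_ne_zero
  have hne : deriv f x ≠ 0 := by
    rw [← derivWithin_of_mem_nhds hn]
    exact (h.2.1 x hx').ne'
  exact (hs.map_nhds_eq hne).ge

end IsC1Diffeo

/-! ### One step of Rauzy–Veech induction -/

namespace GIETData

variable {d : ℕ} {T : GIETData d}

lemma topLeft_rescale (T : GIETData d) (l : ℝ) (i : Fin d) :
    (T.rescale l).topLeft i = T.topLeft i / l :=
  (Finset.sum_div _ _ _).symm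

lemma botLeft_rescale (T : GIETData d) (l : ℝ) (i : Fin d) :
    (T.rescale l).botLeft i = T.botLeft i / l :=
  (Finset.sum_div _ _ _).symm

lemma topRight_rescale (T : GIETData d) (l : ℝ) (i : Fin d) :
    (T.rescale l).topRight i = T.topRight i / l := by
  rw [topRight, topRight, topLeft_rescale, add_div]
  rfl

lemma botRight_rescale (T : GIETData d) (l : ℝ) (i : Fin d) :
    (T.rescale l).botRight i = T.botRight i / l := by
  rw [botRight, botRight, botLeft_rescale, add_div]
  rfl

/-- Up to the affine normalization, `T` is a `C¹` GIET of the interval `[0, l]`. -/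
structure IsC1GIETOn (T : GIETData d) (l : ℝ) : Prop where
  irreducible : T.comb.Irreducible
  lenT_pos : ∀ i, 0 < T.lenT i
  lenB_pos : ∀ i, 0 < T.lenB i
  sum_lenT : ∑ i, T.lenT i = l
  sum_lenB : ∑ i, T.lenB i = l
  diffeo : ∀ i, IsC1Diffeo (T.branch i) (T.topLeft i) (T.topRight i) (T.botLeft i) (T.botRight i)

lemma topLeft_lt_topRight (h : ∀ i, 0 < T.lenT i) (i : Fin d) : T.topLeft i < T.topRight i := by
  rw [topRight]
  linarith [h i]

lemma IsC1GIETOn.rescale {l : ℝ} (h : T.IsC1GIETOn l) (hl : 0 < l) : (T.rescale l).IsC1GIET where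
  irreducible := h.irreducible
  lenT_pos i := div_pos (h.lenT_pos i) hl
  lenB_pos i := div_pos (h.lenB_pos i) hl
  sum_lenT := by
    have := h.sum_lenT
    simp only [GIETData.rescale, ← Finset.sum_div, this, div_self hl.ne']
  sum_lenB := by
    have := h.sum_lenB
    simp only [GIETData.rescale, ← Finset.sum_div, this, div_self hl.ne']
  diffeo i := by
    rw [topLeft_rescale, topRight_rescale, botLeft_rescale, botRight_rescale]
    exact (h.diffeo i).rescale (topLeft_lt_topRight h.lenT_pos i) hl

lemma IsC1GIET.topLeft_lt (h : T.IsC1GIET) (i : Fin d) : T.topLeft i < T.topRight i :=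
  topLeft_lt_topRight h.lenT_pos i

lemma IsC1GIET.topLeft_nonneg (h : T.IsC1GIET) (i : Fin d) : 0 ≤ T.topLeft i :=
  leftSum_nonneg T.comb.top (fun j => (h.lenT_pos j).le) i

lemma IsC1GIET.botLeft_nonneg (h : T.IsC1GIET) (i : Fin d) : 0 ≤ T.botLeft i :=
  leftSum_nonneg T.comb.bot (fun j => (h.lenB_pos j).le) i

lemma IsC1GIET.topRight_le_one (h : T.IsC1GIET) (i : Fin d) : T.topRight i ≤ 1 :=
  (leftSum_add_le_sum T.comb.top (fun j => (h.lenT_pos j).le) i).trans h.sum_lenT.le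

lemma IsC1GIET.botRight_le_one (h : T.IsC1GIET) (i : Fin d) : T.botRight i ≤ 1 :=
  (leftSum_add_le_sum T.comb.bot (fun j => (h.lenB_pos j).le) i).trans h.sum_lenB.le

lemma IsC1GIET.exists_mem (h : T.IsC1GIET) {x : ℝ} (hx : x ∈ Ico (0 : ℝ) 1) :
    ∃ i, x ∈ Ico (T.topLeft i) (T.topRight i) :=
  exists_mem_Ico_leftSum T.comb.top T.lenT hx.1 (by rw [h.sum_lenT]; exact hx.2)

lemma IsC1GIET.eq_of_mem (h : T.IsC1GIET) {x : ℝ} {i j : Fin d}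
    (hi : x ∈ Ico (T.topLeft i) (T.topRight i)) (hj : x ∈ Ico (T.topLeft j) (T.topRight j)) :
    i = j :=
  eq_of_mem_Ico_leftSum T.comb.top (fun j => (h.lenT_pos j).le) hi hj

variable [NeZero d]

lemma IsC1GIET.topRight_top (h : T.IsC1GIET) : T.topRight (T.comb.top ⊤) = 1 :=
  (leftSum_top_add T.comb.top T.lenT).trans h.sum_lenT

lemma IsC1GIET.botRight_bot (h : T.IsC1GIET) : T.botRight (T.comb.bot ⊤) = 1 :=
  (leftSum_top_add T.comb.bot T.lenB).trans h.sum_lenB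

lemma IsC1GIET.topRight_le (h : T.IsC1GIET) {i : Fin d} (hi : i ≠ T.comb.top ⊤) :
    T.topRight i ≤ T.topLeft (T.comb.top ⊤) :=
  leftSum_add_le_top T.comb.top (fun j => (h.lenT_pos j).le) hi

lemma IsC1GIET.botRight_le (h : T.IsC1GIET) {i : Fin d} (hi : i ≠ T.comb.bot ⊤) :
    T.botRight i ≤ T.botLeft (T.comb.bot ⊤) :=
  leftSum_add_le_top T.comb.bot (fun j => (h.lenB_pos j).le) hi

/-- The length of the interval of induction: the larger of the left endpoints of the last top and
bottom intervals. -/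
def cut (T : GIETData d) : ℝ :=
  match T.winType with
  | .top => T.botLeft (T.comb.bot ⊤)
  | .bot => T.topLeft (T.comb.top ⊤)

/-- The arrow of the Rauzy diagram followed by `T`. -/
def arrow (T : GIETData d) : RauzyArrow d := ⟨T.comb, T.winType⟩

/-- Description of the first return map `R` to `[0, l)` before rescaling, uniformly in the type of
the step: points return at time one, except those of the interval of the loser, which return at
time two. -/
structure IsStep (T R : GIETData d) (l : ℝ) : Prop where
  giet : R.IsC1GIETOn l
  pos : 0 < l
  lt_one : l < 1
  topLeft_le : T.topLeft (T.comb.top ⊤) ≤ l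
  botRight_le : T.botRight (T.comb.top ⊤) ≤ l
  cases_l : T.topLeft (T.comb.top ⊤) < l ∨ (l = T.topLeft (T.comb.top ⊤) ∧
    T.botLeft (T.comb.bot ⊤) < l)
  branch_ne : ∀ i, i ≠ T.arrow.loser → R.branch i = T.branch i
  branch_loser : R.branch T.arrow.loser = T.branch (T.comb.top ⊤) ∘ T.branch (T.comb.bot ⊤)
  subset_ne : ∀ i, i ≠ T.arrow.loser →
    Icc (R.topLeft i) (R.topRight i) ⊆ Icc (T.topLeft i) (T.topRight i)
  subset_loser : Icc (R.topLeft T.arrow.loser) (R.topRight T.arrow.loser) ⊆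
    Icc (T.topLeft (T.comb.bot ⊤)) (T.topRight (T.comb.bot ⊤))
  mapsTo_loser : MapsTo (T.branch (T.comb.bot ⊤))
    (Icc (R.topLeft T.arrow.loser) (R.topRight T.arrow.loser)) (Icc l 1)
  mem_of_lt : ∀ i, ∀ x ∈ Ico (T.topLeft i) (T.topRight i), x < l → T.branch i x < l →
    i ≠ T.arrow.loser ∧ x ∈ Ico (R.topLeft i) (R.topRight i)
  mem_of_le : ∀ i, ∀ x ∈ Ico (T.topLeft i) (T.topRight i), x < l → l ≤ T.branch i x →
    i = T.comb.bot ⊤ ∧ x ∈ Ico (R.topLeft T.arrow.loser) (R.topRight T.arrow.loser)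

lemma isStep_inducedTop (h : T.IsC1GIET) (hd : 2 ≤ d)
    (hw : T.lenB (T.comb.bot ⊤) < T.lenT (T.comb.top ⊤)) :
    T.IsStep T.inducedTop (T.botLeft (T.comb.bot ⊤)) := by
  have hne := h.irreducible.top_ne_bot hd
  have hα1 := h.topRight_top
  have hβ1 := h.botRight_bot
  have hαB := h.botRight_le hne
  have hβT := h.topRight_le hne.symm
  have hα0 := h.topLeft_nonneg (T.comb.top ⊤)
  have hT := h.lenT_pos
  have hB := h.lenB_pos
  have hloser : T.arrow.loser = T.comb.bot ⊤ := by
    simp only [arrow, winType, if_pos hw, RauzyArrow.loser]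
  have htr := topRight.eq_1 T
  have hbr := botRight.eq_1 T
  set α := T.comb.top ⊤ with hα
  set β := T.comb.bot ⊤ with hβ
  set l := T.botLeft β with hl
  have hl1 : l < 1 := by linarith [hbr β, hB β]
  have hαl : T.topLeft α < l := by linarith [htr α, hbr β]
  have hlα : l ∈ Ioo (T.topLeft α) (T.topRight α) := ⟨hαl, by linarith⟩
  have hy1 : T.botLeft α < T.branch α l := (h.diffeo α).left_lt ⟨hlα.1, hlα.2.le⟩
  have hy2 : T.branch α l < T.botRight α := (h.diffeo α).lt_right ⟨hlα.1.le, hlα.2⟩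
  have eT : T.inducedTop.lenT = Function.update T.lenT α (l - T.topLeft α) := rfl
  have eB : T.inducedTop.lenB = Function.update (Function.update T.lenB α
    (T.branch α l - T.botLeft α)) β (T.botRight α - T.branch α l) := rfl
  have eb : T.inducedTop.branch = Function.update T.branch β (T.branch α ∘ T.branch β) := rfl
  have eTα : T.inducedTop.lenT α = l - T.topLeft α := by rw [eT, Function.update_self]
  have eTn : ∀ i, i ≠ α → T.inducedTop.lenT i = T.lenT i := fun i hi => by
    rw [eT, Function.update_of_ne hi]
  have eBβ : T.inducedTop.lenB β = T.botRight α - T.branch α l := by rw [eB, Function.update_self]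
  have eBα : T.inducedTop.lenB α = T.branch α l - T.botLeft α := by
    rw [eB, Function.update_of_ne hne, Function.update_self]
  have eBn : ∀ i, i ≠ α → i ≠ β → T.inducedTop.lenB i = T.lenB i := fun i hi hi' => by
    rw [eB, Function.update_of_ne hi', Function.update_of_ne hi]
  have ebβ : T.inducedTop.branch β = T.branch α ∘ T.branch β := by rw [eb, Function.update_self]
  have ebn : ∀ i, i ≠ β → T.inducedTop.branch i = T.branch i := fun i hi => by
    rw [eb, Function.update_of_ne hi]
  have tl : ∀ i, T.inducedTop.topLeft i = T.topLeft i := fun i =>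
    leftSum_congr_of_ne_top T.comb.top (len := T.lenT) (len' := T.inducedTop.lenT) eTn i
  have trα : T.inducedTop.topRight α = l := by rw [topRight, tl, eTα]; ring
  have trn : ∀ i, i ≠ α → T.inducedTop.topRight i = T.topRight i := fun i hi => by
    rw [topRight, tl, eTn i hi, topRight]
  have bln : ∀ i, i ≠ β → T.inducedTop.botLeft i = T.botLeft i := fun i hi =>
    leftSum_moveLastAfter T.comb.bot (a := α) hne (len := T.lenB) (len' := T.inducedTop.lenB)
      (by rw [eBα, ← hβ, eBβ, hbr]; ring) eBn hi
  have blβ : T.inducedTop.botLeft β = T.branch α l := by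
    refine (leftSum_moveLastAfter_last T.comb.bot (a := α) hne (len := T.lenB)
      (len' := T.inducedTop.lenB) eBn).trans ?_
    rw [eBα]
    change T.botLeft α + _ = _
    ring
  have brα : T.inducedTop.botRight α = T.branch α l := by
    rw [botRight, bln α hne, eBα]; ring
  have brβ : T.inducedTop.botRight β = T.botRight α := by
    rw [botRight, blβ, eBβ]; ring
  have brn : ∀ i, i ≠ α → i ≠ β → T.inducedTop.botRight i = T.botRight i := fun i hi hi' => by
    rw [botRight, bln i hi', eBn i hi hi', botRight]
  have hmaps : MapsTo (T.branch β) (Icc (T.topLeft β) (T.topRight β)) (Icc l 1) := by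
    have := (h.diffeo β).mapsTo_Icc
    rwa [hβ1] at this
  refine
    { giet := ?_, pos := hα0.trans_lt hαl, lt_one := hl1, topLeft_le := hαl.le
      botRight_le := hαB, cases_l := Or.inl hαl, branch_ne := ?_, branch_loser := ?_
      subset_ne := ?_, subset_loser := ?_, mapsTo_loser := ?_, mem_of_lt := ?_, mem_of_le := ?_ }
  · refine ⟨h.irreducible.move hd .top, fun i => ?_, fun i => ?_, ?_, ?_, fun i => ?_⟩
    · rcases eq_or_ne i α with rfl | hi
      · rw [eTα]; linarith
      · rw [eTn i hi]; exact hT i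
    · rcases eq_or_ne i β with rfl | hi
      · rw [eBβ]; linarith
      rcases eq_or_ne i α with rfl | hi'
      · rw [eBα]; linarith
      · rw [eBn i hi' hi]; exact hB i
    · have := leftSum_top_add T.comb.top T.inducedTop.lenT
      rw [← this]
      exact trα
    -- The new bottom intervals `α` and `β` together fill the old bottom interval `α`, so exactly
    -- the old length of `β` disappears from the total.
    · have h1 : ∑ i, T.inducedTop.lenB i = ∑ i, (if i = β then 0 else T.lenB i) := by
        refine sum_congr_pair hne ?_ fun j hj hj' => ?_
        · rw [eBα, eBβ, if_neg hne, if_pos rfl, hbr]; ring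
        · rw [eBn j hj hj', if_neg hj']
      have h2 : ∑ i, (if i = β then 0 else T.lenB i) = ∑ i, T.lenB i - T.lenB β := by
        rw [eq_sub_iff_add_eq', ← Finset.add_sum_erase _ T.lenB (Finset.mem_univ β),
          ← Finset.add_sum_erase _ (fun i => if i = β then 0 else T.lenB i) (Finset.mem_univ β),
          if_pos rfl, zero_add]
        congr 1
        refine Finset.sum_congr rfl fun j hj => if_neg (Finset.ne_of_mem_erase hj)
      rw [h1, h2, h.sum_lenB]
      linarith [hbr β]
    · rcases eq_or_ne i β with rfl | hi
      · rw [ebβ, tl, trn _ hne.symm, blβ, brβ]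
        have hr := (h.diffeo α).restrict hαl.le hlα.2 le_rfl
        rw [(h.diffeo α).2.2.2, hα1] at hr
        have hf := h.diffeo β
        rw [hβ1] at hf
        exact hr.comp hf (h.topLeft_lt _)
      rcases eq_or_ne i α with rfl | hi'
      · rw [ebn _ hne, tl, trα, bln _ hne, brα]
        have hr := (h.diffeo α).restrict le_rfl hαl hlα.2.le
        rwa [(h.diffeo α).2.2.1] at hr
      · rw [ebn _ hi, tl, trn _ hi', bln _ hi, brn _ hi' hi]
        exact h.diffeo i
  · rw [hloser]; exact ebn
  · rw [hloser]; exact ebβ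
  · intro i _
    rcases eq_or_ne i α with rfl | hi'
    · rw [tl, trα]; exact Icc_subset_Icc_right hlα.2.le
    · rw [tl, trn i hi']
  · rw [hloser, tl, trn _ hne.symm]
  · rw [hloser, tl, trn _ hne.symm]; exact hmaps
  · intro i x hx hxl hy
    have hi : i ≠ β := by
      rintro rfl
      exact absurd (hmaps (Ico_subset_Icc_self hx)).1 (not_le.2 hy)
    rw [hloser]
    refine ⟨hi, ?_⟩
    rcases eq_or_ne i α with rfl | hi'
    · rw [tl, trα]; exact ⟨hx.1, hxl⟩
    · rw [tl, trn i hi']; exact hx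
  · intro i x hx hxl hy
    have hi : i = β := by
      by_contra hi
      linarith [(h.diffeo i).lt_right hx, h.botRight_le hi]
    subst hi
    rw [hloser, tl, trn _ hne.symm]
    exact ⟨rfl, hx⟩

lemma isStep_inducedBot (h : T.IsC1GIET) (hd : 2 ≤ d)
    (hw : T.lenT (T.comb.top ⊤) < T.lenB (T.comb.bot ⊤)) :
    T.IsStep T.inducedBot (T.topLeft (T.comb.top ⊤)) := by
  have hne := h.irreducible.top_ne_bot hd
  have hα1 := h.topRight_top
  have hβ1 := h.botRight_bot
  have hαB := h.botRight_le hne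
  have hβT := h.topRight_le hne.symm
  have hβ0 := h.botLeft_nonneg (T.comb.bot ⊤)
  have hT := h.lenT_pos
  have hB := h.lenB_pos
  have hloser : T.arrow.loser = T.comb.top ⊤ := by
    simp only [arrow, winType, if_neg hw.not_gt, RauzyArrow.loser]
  have htr := topRight.eq_1 T
  have hbr := botRight.eq_1 T
  set α := T.comb.top ⊤ with hα
  set β := T.comb.bot ⊤ with hβ
  set l := T.topLeft α with hl
  have hl1 : l < 1 := by linarith [htr α, hT α]
  have hβl : T.botLeft β < l := by linarith [htr α, hbr β]
  obtain ⟨w, hw1, hw2⟩ := (h.diffeo β).exists_preimage (h.topLeft_lt β).le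
    (y := l) ⟨hβl, by linarith⟩
  set z := Function.invFunOn (T.branch β) (Icc (T.topLeft β) (T.topRight β)) l with hz
  have hex : ∃ x ∈ Icc (T.topLeft β) (T.topRight β), T.branch β x = l :=
    ⟨w, Ioo_subset_Icc_self hw1, hw2⟩
  have hz2 : T.branch β z = l := Function.invFunOn_eq hex
  -- `invFunOn` only promises a point of the closed interval; injectivity identifies it with the
  -- interior preimage `w`.
  have hz1 : z ∈ Ioo (T.topLeft β) (T.topRight β) := by
    have hzw : z = w := (h.diffeo β).strictMonoOn.injOn (Function.invFunOn_mem hex)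
      (Ioo_subset_Icc_self hw1) (hz2.trans hw2.symm)
    rwa [hzw]
  have eT : T.inducedBot.lenT = Function.update (Function.update T.lenT β (z - T.topLeft β)) α
    (T.topRight β - z) := rfl
  have eB : T.inducedBot.lenB = Function.update T.lenB β (l - T.botLeft β) := rfl
  have eb : T.inducedBot.branch = Function.update T.branch α (T.branch α ∘ T.branch β) := rfl
  have eBβ : T.inducedBot.lenB β = l - T.botLeft β := by rw [eB, Function.update_self]
  have eBn : ∀ i, i ≠ β → T.inducedBot.lenB i = T.lenB i := fun i hi => by
    rw [eB, Function.update_of_ne hi]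
  have eTα : T.inducedBot.lenT α = T.topRight β - z := by rw [eT, Function.update_self]
  have eTβ : T.inducedBot.lenT β = z - T.topLeft β := by
    rw [eT, Function.update_of_ne hne.symm, Function.update_self]
  have eTn : ∀ i, i ≠ β → i ≠ α → T.inducedBot.lenT i = T.lenT i := fun i hi hi' => by
    rw [eT, Function.update_of_ne hi', Function.update_of_ne hi]
  have ebα : T.inducedBot.branch α = T.branch α ∘ T.branch β := by rw [eb, Function.update_self]
  have ebn : ∀ i, i ≠ α → T.inducedBot.branch i = T.branch i := fun i hi => by
    rw [eb, Function.update_of_ne hi]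
  have bl : ∀ i, T.inducedBot.botLeft i = T.botLeft i := fun i =>
    leftSum_congr_of_ne_top T.comb.bot (len := T.lenB) (len' := T.inducedBot.lenB) eBn i
  have brβ : T.inducedBot.botRight β = l := by rw [botRight, bl, eBβ]; ring
  have brn : ∀ i, i ≠ β → T.inducedBot.botRight i = T.botRight i := fun i hi => by
    rw [botRight, bl, eBn i hi, botRight]
  have tln : ∀ i, i ≠ α → T.inducedBot.topLeft i = T.topLeft i := fun i hi =>
    leftSum_moveLastAfter T.comb.top (a := β) hne.symm (len := T.lenT)
      (len' := T.inducedBot.lenT) (by rw [eTβ, ← hα, eTα, htr]; ring) eTn hi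
  have tlα : T.inducedBot.topLeft α = z := by
    refine (leftSum_moveLastAfter_last T.comb.top (a := β) hne.symm (len := T.lenT)
      (len' := T.inducedBot.lenT) eTn).trans ?_
    rw [eTβ]
    change T.topLeft β + _ = _
    ring
  have trβ : T.inducedBot.topRight β = z := by
    rw [topRight, tln β hne.symm, eTβ]; ring
  have trα : T.inducedBot.topRight α = T.topRight β := by
    rw [topRight, tlα, eTα]; ring
  have trn : ∀ i, i ≠ β → i ≠ α → T.inducedBot.topRight i = T.topRight i := fun i hi hi' => by
    rw [topRight, tln i hi', eTn i hi hi', topRight]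
  have hfβ := (h.diffeo β).restrict hz1.1.le hz1.2 le_rfl
  rw [hz2, (h.diffeo β).2.2.2, hβ1] at hfβ
  refine
    { giet := ?_, pos := hβ0.trans_lt hβl, lt_one := hl1, topLeft_le := le_rfl
      botRight_le := by linarith, cases_l := Or.inr ⟨rfl, hβl⟩, branch_ne := ?_
      branch_loser := ?_, subset_ne := ?_, subset_loser := ?_, mapsTo_loser := ?_
      mem_of_lt := ?_, mem_of_le := ?_ }
  · refine ⟨h.irreducible.move hd .bot, fun i => ?_, fun i => ?_, ?_, ?_, fun i => ?_⟩
    · rcases eq_or_ne i α with rfl | hi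
      · rw [eTα]; linarith [hz1.2]
      rcases eq_or_ne i β with rfl | hi'
      · rw [eTβ]; linarith [hz1.1]
      · rw [eTn i hi' hi]; exact hT i
    · rcases eq_or_ne i β with rfl | hi
      · rw [eBβ]; linarith
      · rw [eBn i hi]; exact hB i
    · have h1 : ∑ i, T.inducedBot.lenT i = ∑ i, (if i = α then 0 else T.lenT i) := by
        refine sum_congr_pair hne.symm ?_ fun j hj hj' => ?_
        · rw [eTα, eTβ, if_neg hne.symm, if_pos rfl, htr]; ring
        · rw [eTn j hj hj', if_neg hj']
      have h2 : ∑ i, (if i = α then 0 else T.lenT i) = ∑ i, T.lenT i - T.lenT α := by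
        rw [eq_sub_iff_add_eq', ← Finset.add_sum_erase _ T.lenT (Finset.mem_univ α),
          ← Finset.add_sum_erase _ (fun i => if i = α then 0 else T.lenT i) (Finset.mem_univ α),
          if_pos rfl, zero_add]
        congr 1
        refine Finset.sum_congr rfl fun j hj => if_neg (Finset.ne_of_mem_erase hj)
      rw [h1, h2, h.sum_lenT]
      linarith [htr α]
    · have := leftSum_top_add T.comb.bot T.inducedBot.lenB
      rw [← this]
      exact brβ
    · rcases eq_or_ne i α with rfl | hi
      · rw [ebα, tlα, trα, bl, brn _ hne]
        have hr := h.diffeo α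
        rw [hα1] at hr
        exact hr.comp hfβ hz1.2
      rcases eq_or_ne i β with rfl | hi'
      · rw [ebn _ hi, tln _ hi, trβ, bl, brβ]
        have hr := (h.diffeo β).restrict le_rfl hz1.1 hz1.2.le
        rwa [(h.diffeo β).2.2.1, hz2] at hr
      · rw [ebn _ hi, tln _ hi, trn _ hi' hi, bl, brn _ hi']
        exact h.diffeo i
  · rw [hloser]; exact ebn
  · rw [hloser]; exact ebα
  · rw [hloser]
    intro i hi
    rcases eq_or_ne i β with rfl | hi'
    · rw [tln _ hi, trβ]; exact Icc_subset_Icc_right hz1.2.le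
    · rw [tln _ hi, trn i hi' hi]
  · rw [hloser, tlα, trα]; exact Icc_subset_Icc_left hz1.1.le
  · rw [hloser, tlα, trα]; exact hfβ.mapsTo_Icc
  · intro i x hx hxl hy
    have hi : i ≠ α := by
      rintro rfl
      exact absurd hx.1 (not_le.2 hxl)
    rw [hloser]
    refine ⟨hi, ?_⟩
    rcases eq_or_ne i β with rfl | hi'
    · rw [tln _ hi, trβ]
      refine ⟨hx.1, ?_⟩
      rw [← hz2] at hy
      exact ((h.diffeo _).strictMonoOn.lt_iff_lt (Ico_subset_Icc_self hx)
        (Ioo_subset_Icc_self hz1)).1 hy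
    · rw [tln _ hi, trn i hi' hi]; exact hx
  · intro i x hx hxl hy
    have hi : i = β := by
      by_contra hi
      linarith [(h.diffeo i).lt_right hx, h.botRight_le hi]
    subst hi
    rw [hloser, tlα, trα]
    refine ⟨rfl, ?_, hx.2⟩
    rw [← hz2] at hy
    exact ((h.diffeo _).strictMonoOn.le_iff_le (Ioo_subset_Icc_self hz1)
      (Ico_subset_Icc_self hx)).1 hy

/-- The first return map of an elementary step, before rescaling. -/
def induced (T : GIETData d) : GIETData d :=
  match T.winType with
  | .top => T.inducedTop
  | .bot => T.inducedBot

lemma rauzyVeech_eq (T : GIETData d) : T.rauzyVeech = T.induced.rescale T.cut := by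
  unfold rauzyVeech induced cut
  cases T.winType <;> rfl

lemma isStep_induced (h : T.IsC1GIET) (hd : 2 ≤ d) (hr : T.Renormalizable) :
    T.IsStep T.induced T.cut := by
  unfold induced cut winType
  by_cases hw : T.lenB (T.comb.bot ⊤) < T.lenT (T.comb.top ⊤)
  · simp only [if_pos hw]
    exact isStep_inducedTop h hd hw
  · simp only [if_neg hw]
    exact isStep_inducedBot h hd (lt_of_le_of_ne (not_lt.1 hw) hr)

lemma IsC1GIET.rauzyVeech (h : T.IsC1GIET) (hd : 2 ≤ d) (hr : T.Renormalizable) :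
    T.rauzyVeech.IsC1GIET := by
  have hs := isStep_induced h hd hr
  rw [rauzyVeech_eq]
  exact hs.giet.rescale hs.pos

end GIETData

/-! ### Logarithmic slopes -/

namespace GIETData

variable {d : ℕ} {T : GIETData d}

/-- Logarithm of the derivative of the branch `i`. -/
def logSlope (T : GIETData d) (i : Fin d) (x : ℝ) : ℝ :=
  Real.log (derivWithin (T.branch i) (Icc (T.topLeft i) (T.topRight i)) x)

lemma IsC1GIET.continuousOn_logSlope (h : T.IsC1GIET) (i : Fin d) :
    ContinuousOn (T.logSlope i) (Icc (T.topLeft i) (T.topRight i)) :=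
  ((h.diffeo i).continuousOn_derivWithin (h.topLeft_lt i)).log
    fun x hx => ((h.diffeo i).2.1 x hx).ne'

lemma IsC1GIETOn.logSlope_rescale {l : ℝ} (h : T.IsC1GIETOn l) (hl : 0 < l) {i : Fin d} {x : ℝ}
    (hx : x ∈ Icc (T.topLeft i) (T.topRight i)) :
    (T.rescale l).logSlope i (x / l) = T.logSlope i x := by
  unfold logSlope
  rw [topLeft_rescale, topRight_rescale]
  have := (h.diffeo i).derivWithin_rescale (topLeft_lt_topRight h.lenT_pos i) hl (x := x / l)
    ⟨div_le_div_of_nonneg_right hx.1 hl.le, div_le_div_of_nonneg_right hx.2 hl.le⟩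
  rw [mul_div_cancel₀ _ hl.ne'] at this
  rw [← this]
  rfl

/-- The absolute value of the logarithmic slope of the branch `i` is at most `c`. -/
def SlopeBound (T : GIETData d) (i : Fin d) (c : ℝ) : Prop :=
  ∀ x ∈ Icc (T.topLeft i) (T.topRight i), |T.logSlope i x| ≤ c

lemma SlopeBound.mono {i : Fin d} {c c' : ℝ} (h : T.SlopeBound i c) (hc : c ≤ c') :
    T.SlopeBound i c' := fun x hx => (h x hx).trans hc

/-- The supremum of the absolute values of the logarithmic slopes. -/
def slopeSup (T : GIETData d) : ℝ := sInf {c | 0 ≤ c ∧ ∀ i, T.SlopeBound i c}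

lemma slopeSup_nonneg (T : GIETData d) : 0 ≤ T.slopeSup := Real.sInf_nonneg fun _ h => h.1

lemma slopeSup_le {c : ℝ} (hc : 0 ≤ c) (h : ∀ i, T.SlopeBound i c) : T.slopeSup ≤ c :=
  csInf_le ⟨0, fun _ h => h.1⟩ ⟨hc, h⟩

lemma IsC1GIET.slopeBound (h : T.IsC1GIET) (i : Fin d) : T.SlopeBound i T.slopeSup := by
  have hb : ∀ i, ∃ c, ∀ x ∈ Icc (T.topLeft i) (T.topRight i), ‖T.logSlope i x‖ ≤ c := fun i =>
    isCompact_Icc.exists_bound_of_continuousOn (h.continuousOn_logSlope i)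
  choose c hc using hb
  intro x hx
  -- Compactness supplies a common bound. It makes the set of bounds nonempty, which is needed
  -- because a real `sInf` of the empty set is `0`.
  refine le_csInf ⟨∑ j, |c j|, Finset.sum_nonneg fun j _ => abs_nonneg _, fun j y hy => ?_⟩
    fun b hb => hb.2 i x hx
  exact (hc j y hy).trans ((le_abs_self _).trans
    (Finset.single_le_sum (f := fun j => |c j|) (fun k _ => abs_nonneg _) (Finset.mem_univ j)))

/-! ### Logarithmic slopes across one elementary step. -/

section Step

variable [NeZero d] {R : GIETData d} {l : ℝ}

lemma IsStep.logSlope_ne (hs : T.IsStep R l) (h : T.IsC1GIET) {i : Fin d}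
    (hi : i ≠ T.arrow.loser) {x : ℝ} (hx : x ∈ Icc (R.topLeft i) (R.topRight i)) :
    (R.rescale l).logSlope i (x / l) = T.logSlope i x := by
  rw [hs.giet.logSlope_rescale hs.pos hx, logSlope, hs.branch_ne i hi,
    (h.diffeo i).derivWithin_subset (topLeft_lt_topRight hs.giet.lenT_pos i) (hs.subset_ne i hi) hx]
  rfl

/-- Chain rule for the branch that returns at time two. Whichever type wins, its orbit passes
through the last bottom label and then the last top label; rescaling does not change derivatives. -/
lemma IsStep.logSlope_loser (hs : T.IsStep R l) (h : T.IsC1GIET) {x : ℝ}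
    (hx : x ∈ Icc (R.topLeft T.arrow.loser) (R.topRight T.arrow.loser)) :
    (R.rescale l).logSlope T.arrow.loser (x / l)
      = T.logSlope (T.comb.top ⊤) (T.branch (T.comb.bot ⊤) x) + T.logSlope (T.comb.bot ⊤) x := by
  have hlt := topLeft_lt_topRight hs.giet.lenT_pos T.arrow.loser
  have hm := hs.mapsTo_loser
  have hxβ := hs.subset_loser hx
  have hα : Icc l 1 ⊆ Icc (T.topLeft (T.comb.top ⊤)) (T.topRight (T.comb.top ⊤)) :=
    Icc_subset_Icc hs.topLeft_le h.topRight_top.ge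
  have h1 := ((h.diffeo (T.comb.top ⊤)).hasDerivWithinAt (hα (hm hx))).comp x
    (((h.diffeo (T.comb.bot ⊤)).hasDerivWithinAt hxβ).mono hs.subset_loser)
    fun y hy => hα (hm hy)
  rw [hs.giet.logSlope_rescale hs.pos hx, logSlope, hs.branch_loser,
    h1.derivWithin (uniqueDiffOn_Icc hlt x hx), Real.log_mul
      ((h.diffeo (T.comb.top ⊤)).2.1 _ (hα (hm hx))).ne'
      ((h.diffeo (T.comb.bot ⊤)).2.1 _ hxβ).ne']
  rfl

lemma IsStep.exists_eq_div (hs : T.IsStep R l) {i : Fin d} {y : ℝ}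
    (hy : y ∈ Icc ((R.rescale l).topLeft i) ((R.rescale l).topRight i)) :
    ∃ x ∈ Icc (R.topLeft i) (R.topRight i), y = x / l := by
  rw [topLeft_rescale, topRight_rescale] at hy
  exact ⟨l * y, IsC1Diffeo.mul_mem_Icc_of_mem_div hs.pos hy, by
    rw [mul_div_cancel_left₀ _ hs.pos.ne']⟩

lemma IsStep.slopeBound_ne (hs : T.IsStep R l) (h : T.IsC1GIET) {i : Fin d}
    (hi : i ≠ T.arrow.loser) {c : ℝ} (hc : T.SlopeBound i c) : (R.rescale l).SlopeBound i c := by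
  intro y hy
  obtain ⟨x, hx, rfl⟩ := hs.exists_eq_div hy
  rw [hs.logSlope_ne h hi hx]
  exact hc x (hs.subset_ne i hi hx)

lemma IsStep.slopeBound_loser (hs : T.IsStep R l) (h : T.IsC1GIET) {c c' : ℝ}
    (hc : T.SlopeBound (T.comb.top ⊤) c) (hc' : T.SlopeBound (T.comb.bot ⊤) c') :
    (R.rescale l).SlopeBound T.arrow.loser (c + c') := by
  intro y hy
  obtain ⟨x, hx, rfl⟩ := hs.exists_eq_div hy
  rw [hs.logSlope_loser h hx]
  refine (abs_add_le _ _).trans (add_le_add (hc _ ?_) (hc' x (hs.subset_loser hx)))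
  exact Icc_subset_Icc hs.topLeft_le h.topRight_top.ge (hs.mapsTo_loser hx)

lemma winner_loser (T : GIETData d) :
    (T.arrow.winner = T.comb.top ⊤ ∧ T.arrow.loser = T.comb.bot ⊤) ∨
      (T.arrow.winner = T.comb.bot ⊤ ∧ T.arrow.loser = T.comb.top ⊤) := by
  unfold arrow RauzyArrow.winner RauzyArrow.loser
  cases T.winType
  · exact Or.inl ⟨rfl, rfl⟩
  · exact Or.inr ⟨rfl, rfl⟩

lemma IsC1GIET.winner_ne_loser (h : T.IsC1GIET) (hd : 2 ≤ d) :
    T.arrow.winner ≠ T.arrow.loser := by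
  have hne := h.irreducible.top_ne_bot hd
  rcases T.winner_loser with ⟨h1, h2⟩ | ⟨h1, h2⟩ <;> rw [h1, h2]
  exacts [hne, hne.symm]

/-- The move alters only the row of the loser, so the winner remains last in its own row. -/
lemma winner_rauzyVeech (h : T.rauzyVeech.winType = T.winType) :
    T.rauzyVeech.arrow.winner = T.arrow.winner := by
  unfold arrow RauzyArrow.winner
  rw [h]
  unfold rauzyVeech
  cases T.winType <;> rfl

/-- Only the loser's branch is composed, and one factor is always the winner's. Keeping a separate
bound `c` for the winner makes the global bound increase by `c` instead of doubling. -/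
lemma slopeBound_rauzyVeech (h : T.IsC1GIET) (hd : 2 ≤ d) (hr : T.Renormalizable) {c c' : ℝ}
    (h0 : 0 ≤ c) (hw : T.SlopeBound T.arrow.winner c) (ha : ∀ i, T.SlopeBound i c') :
    T.rauzyVeech.SlopeBound T.arrow.winner c ∧ ∀ i, T.rauzyVeech.SlopeBound i (c + c') := by
  have hs := isStep_induced h hd hr
  rw [rauzyVeech_eq]
  refine ⟨hs.slopeBound_ne h (h.winner_ne_loser hd) hw, fun i => ?_⟩
  rcases eq_or_ne i T.arrow.loser with rfl | hi
  · rcases T.winner_loser with ⟨h1, h2⟩ | ⟨h1, h2⟩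
    · rw [h1] at hw
      exact hs.slopeBound_loser h hw (ha _)
    · rw [h1] at hw
      rw [add_comm]
      exact hs.slopeBound_loser h (ha _) hw
  · exact hs.slopeBound_ne h hi ((ha i).mono (by linarith))

end Step

/-! ### Slopes of GIETs close to standard IETs -/

lemma IsC1GIET.derivWithin_profile (h : T.IsC1GIET) (i : Fin d) {t : ℝ} (ht : t ∈ Icc (0 : ℝ) 1) :
    derivWithin (T.profile i) (Icc 0 1) t = derivWithin (T.branch i)
      (Icc (T.topLeft i) (T.topRight i)) (T.topLeft i + T.lenT i * t) / T.slope i := by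
  have hm : MapsTo (fun t => T.topLeft i + T.lenT i * t) (Icc 0 1)
      (Icc (T.topLeft i) (T.topRight i)) := fun s hs => by
    have := h.lenT_pos i
    exact ⟨by nlinarith [hs.1], by rw [topRight]; nlinarith [hs.2]⟩
  have h1 : HasDerivWithinAt (fun t => T.topLeft i + T.lenT i * t) (T.lenT i) (Icc 0 1) t := by
    simpa using ((hasDerivWithinAt_id t (Icc 0 1)).const_mul (T.lenT i)).const_add (T.topLeft i)
  have h2 := ((((h.diffeo i).hasDerivWithinAt (hm ht)).comp t h1 hm).sub_const
    (T.botLeft i)).div_const (T.lenB i)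
  have h3 := h2.derivWithin (uniqueDiffOn_Icc zero_lt_one t ht)
  refine h3.trans ?_
  have := (h.lenT_pos i).ne'
  have := (h.lenB_pos i).ne'
  rw [slope]
  field_simp

lemma IsIET.slope_eq (h : T.IsIET) (i : Fin d) : T.slope i = 1 := by
  rw [slope, h.2.1 i, div_self (h.1.lenB_pos i).ne']

lemma IsIET.derivWithin_profile (h : T.IsIET) (i : Fin d) {t : ℝ} (ht : t ∈ Icc (0 : ℝ) 1) :
    derivWithin (T.profile i) (Icc 0 1) t = 1 := by
  have hx : T.topLeft i + T.lenT i * t ∈ Icc (T.topLeft i) (T.topRight i) := by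
    have := h.1.lenT_pos i
    exact ⟨by nlinarith [ht.1], by rw [topRight]; nlinarith [ht.2]⟩
  rw [h.1.derivWithin_profile i ht, h.slope_eq, div_one]
  obtain ⟨δ, hδ⟩ := h.2.2 i
  rw [derivWithin_congr hδ (hδ _ hx)]
  exact ((hasDerivWithinAt_id _ _).add_const δ).derivWithin
    (uniqueDiffOn_Icc (h.1.topLeft_lt i) _ hx)

lemma abs_log_le {u : ℝ} (hu : |u - 1| ≤ 1 / 2) : |Real.log u| ≤ 2 * |u - 1| := by
  have hu' := abs_le.1 hu
  have hpos : 0 < u := by linarith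
  have h1 := Real.log_le_sub_one_of_pos hpos
  have h2 := Real.one_sub_inv_le_log_of_pos hpos
  have h3 : 1 - u⁻¹ = (u - 1) * u⁻¹ := by field_simp
  have h4 : u⁻¹ ≤ 2 := by
    rw [inv_le_comm₀ hpos two_pos]
    linarith
  have h5 : |(u - 1) * u⁻¹| ≤ 2 * |u - 1| := by
    rw [abs_mul, abs_of_pos (inv_pos.2 hpos), mul_comm]
    exact mul_le_mul_of_nonneg_right h4 (abs_nonneg _)
  rw [abs_le]
  constructor
  · linarith [neg_abs_le ((u - 1) * u⁻¹)]
  · linarith [le_abs_self (u - 1), abs_nonneg (u - 1)]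

/-- The derivative of a branch is its mean slope times the derivative of its profile. Both equal `1`
for a standard IET, so here both are within `ε` of `1`, and each logarithm costs at most `2 * ε`. -/
lemma IsC1GIET.slopeSup_le_of_edistToIET_lt (h : T.IsC1GIET) {ε : ℝ} (hε : ε ≤ 1 / 2)
    (hT : T.edistToIET < ENNReal.ofReal ε) : T.slopeSup ≤ 4 * ε := by
  have hε0 : 0 < ε := ENNReal.ofReal_pos.1 (bot_le.trans_lt hT)
  rw [edistToIET, iInf_lt_iff] at hT
  obtain ⟨S, hT⟩ := hT
  rw [iInf_lt_iff] at hT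
  obtain ⟨hS, hT⟩ := hT
  rw [edistC1, max_lt_iff, max_lt_iff] at hT
  obtain ⟨-, h1, h2⟩ := hT
  refine slopeSup_le (by linarith) fun i x hx => ?_
  have hslope : |T.slope i - 1| ≤ ε := by
    refine le_trans ?_ ((ENNReal.ofReal_lt_ofReal_iff hε0).1 h1).le
    refine Real.abs_le_sqrt ?_
    have := Finset.single_le_sum (f := fun i => (T.slope i - S.slope i) ^ 2)
      (fun j _ => sq_nonneg _) (Finset.mem_univ i)
    rw [hS.slope_eq] at this
    refine this.trans (le_add_of_nonneg_left (Finset.sum_nonneg fun j _ => sq_nonneg _))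
  have hlen := h.lenT_pos i
  set t := (x - T.topLeft i) / T.lenT i with ht
  have htm : t ∈ Icc (0 : ℝ) 1 := by
    have := hx.2
    rw [topRight] at this
    rw [ht, mem_Icc, le_div_iff₀ hlen, div_le_iff₀ hlen]
    constructor <;> linarith [hx.1]
  have hxt : T.topLeft i + T.lenT i * t = x := by
    rw [ht]; field_simp; ring
  have hprof : |derivWithin (T.profile i) (Icc 0 1) t - 1| ≤ ε := by
    have h3 : edistC1Fun (T.profile i) (S.profile i) < ENNReal.ofReal ε :=
      (Finset.single_le_sum (f := fun i => edistC1Fun (T.profile i) (S.profile i))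
        (fun j _ => bot_le) (Finset.mem_univ i)).trans_lt h2
    have h4 := (le_add_self.trans_lt h3 : (⨆ x ∈ Icc (0 : ℝ) 1, ENNReal.ofReal
      |derivWithin (T.profile i) (Icc 0 1) x - derivWithin (S.profile i) (Icc 0 1) x|) < _)
    have h5 := (le_iSup₂ (f := fun (x : ℝ) (_ : x ∈ Icc (0 : ℝ) 1) => ENNReal.ofReal
      |derivWithin (T.profile i) (Icc 0 1) x - derivWithin (S.profile i) (Icc 0 1) x|)
      t htm).trans_lt h4
    rw [hS.derivWithin_profile i htm] at h5
    exact ((ENNReal.ofReal_lt_ofReal_iff hε0).1 h5).le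
  have hd := h.derivWithin_profile i htm
  have hsp : 0 < T.slope i := div_pos (h.lenB_pos i) hlen
  rw [hxt, eq_div_iff hsp.ne'] at hd
  have hpp : derivWithin (T.profile i) (Icc 0 1) t ≠ 0 := by
    intro h0
    rw [h0, zero_sub, abs_neg, abs_one] at hprof
    linarith
  rw [logSlope, ← hd, Real.log_mul hpp hsp.ne']
  have e1 := abs_log_le (hslope.trans hε)
  have e2 := abs_log_le (hprof.trans hε)
  linarith [abs_add_le (Real.log (derivWithin (T.profile i) (Icc 0 1) t)) (Real.log (T.slope i))]

end GIETData

/-! ### Zorich times and the growth of the cocycle -/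

section Cocycle

variable {d : ℕ}

lemma prodFrom_add (M : ℕ → Matrix (Fin d) (Fin d) ℝ) (m a b : ℕ) :
    prodFrom M m (a + b) = prodFrom M (m + a) b * prodFrom M m a := by
  induction b with
  | zero => simp [prodFrom]
  | succ b ih => rw [← add_assoc, prodFrom, prodFrom, ih, Matrix.mul_assoc, add_assoc]

/-- Steps of both types occur after any time. -/
def TypesAlternate (γ : ℕ → RauzyArrow d) : Prop := ∀ N, ∃ n, N < n ∧ (γ n).type ≠ (γ N).type

variable {γ : ℕ → RauzyArrow d}

/-- Alternation makes the set in the definition nonempty, so its infimum is attained and is not the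
default value `0`. -/
lemma TypesAlternate.zorichTime_spec (h : TypesAlternate γ) (k : ℕ) :
    zorichTime γ k < zorichTime γ (k + 1) ∧
      (γ (zorichTime γ (k + 1))).type ≠ (γ (zorichTime γ k)).type :=
  Nat.sInf_mem (s := {n | zorichTime γ k < n ∧ (γ n).type ≠ (γ (zorichTime γ k)).type}) (h _)

lemma type_eq_of_lt_zorichTime {k n : ℕ} (h1 : zorichTime γ k ≤ n)
    (h2 : n < zorichTime γ (k + 1)) : (γ n).type = (γ (zorichTime γ k)).type := by
  by_contra hne
  rcases h1.eq_or_lt with rfl | h1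
  · exact hne rfl
  · exact Nat.notMem_of_lt_sInf h2 ⟨h1, hne⟩

lemma TypesAlternate.strictMono_zorichTime (h : TypesAlternate γ) : StrictMono (zorichTime γ) :=
  strictMono_nat_of_lt_succ fun k => (h.zorichTime_spec k).1

variable [NeZero d]

/-- Each new factor adds the winner's row to the loser's row. The entries stay above those of the
identity, so the added row has sum at least `1`, and the total of the entries grows by at least one
per step. -/
lemma prodFrom_matrix_ge (γ : ℕ → RauzyArrow d) (m l : ℕ) :
    (∀ i j, (1 : Matrix (Fin d) (Fin d) ℝ) i j ≤ prodFrom (fun n => (γ n).matrix) m l i j) ∧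
      (l : ℝ) ≤ ∑ i, ∑ j, prodFrom (fun n => (γ n).matrix) m l i j := by
  have hone : ∀ i j, 0 ≤ (1 : Matrix (Fin d) (Fin d) ℝ) i j := fun i j => by
    rw [Matrix.one_apply]; split_ifs <;> norm_num
  induction l with
  | zero =>
    refine ⟨fun i j => le_rfl, ?_⟩
    simpa [prodFrom] using Finset.sum_nonneg fun i _ => Finset.sum_nonneg fun j _ => hone i j
  | succ l ih =>
    obtain ⟨ih1, ih2⟩ := ih
    set P := prodFrom (fun n => (γ n).matrix) m l with hP
    set a := γ (m + l)
    have hnn : ∀ i j, 0 ≤ P i j := fun i j => (hone i j).trans (ih1 i j)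
    have hmul : ∀ i j, prodFrom (fun n => (γ n).matrix) m (l + 1) i j
        = P i j + if i = a.loser then P a.winner j else 0 := fun i j => by
      rw [prodFrom, ← hP]
      change ((1 + Matrix.single a.loser a.winner 1 : Matrix (Fin d) (Fin d) ℝ) * P) i j = _
      rw [Matrix.add_mul, Matrix.one_mul, Matrix.add_apply]
      congr 1
      split_ifs with hi
      · subst hi; simp
      · rw [Matrix.single_mul_apply_of_ne]
        exact hi
    refine ⟨fun i j => ?_, ?_⟩
    · rw [hmul]
      have := ih1 i j
      split_ifs <;> linarith [hnn a.winner j]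
    · have h1 : ∑ i, ∑ j, prodFrom (fun n => (γ n).matrix) m (l + 1) i j
          = ∑ i, ∑ j, P i j + ∑ j, P a.winner j := by
        simp only [hmul, Finset.sum_add_distrib]
        congr 1
        rw [Finset.sum_eq_single a.loser]
        · simp
        · intro i _ hi; simp [hi]
        · simp
      have h2 : 1 ≤ ∑ j, P a.winner j := by
        have := ih1 a.winner a.winner
        rw [Matrix.one_apply_eq] at this
        exact this.trans (Finset.single_le_sum (f := fun j => P a.winner j) (fun j _ => hnn _ j)
          (Finset.mem_univ _))
      rw [h1]
      push_cast
      linarith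

lemma le_entryNorm_prodFrom (γ : ℕ → RauzyArrow d) (m l : ℕ) :
    (l : ℝ) ≤ entryNorm (prodFrom (fun n => (γ n).matrix) m l) :=
  (prodFrom_matrix_ge γ m l).2.trans
    (Finset.sum_le_sum fun _ _ => Finset.sum_le_sum fun _ _ => le_abs_self _)

lemma TypesAlternate.prodFrom_zorichMatrix (h : TypesAlternate γ) (m l : ℕ) :
    prodFrom (zorichMatrix γ) m l = prodFrom (fun n => (γ n).matrix) (zorichTime γ m)
      (zorichTime γ (m + l) - zorichTime γ m) := by
  have hmono := h.strictMono_zorichTime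
  induction l with
  | zero => simp [prodFrom]
  | succ l ih =>
    have h1 : zorichTime γ m ≤ zorichTime γ (m + l) := hmono.monotone (by omega)
    have h2 : zorichTime γ (m + l) < zorichTime γ (m + l + 1) := hmono (by omega)
    have h3 : zorichTime γ (m + (l + 1)) - zorichTime γ m
        = (zorichTime γ (m + l) - zorichTime γ m)
          + (zorichTime γ (m + l + 1) - zorichTime γ (m + l)) := by
      rw [← add_assoc]; omega
    rw [prodFrom, ih, zorichMatrix, h3, prodFrom_add]
    congr 2
    omega

/-- The product contains the whole `k`-th Zorich block, and its norm is at least its number of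
elementary factors. -/
lemma TypesAlternate.sub_le_entryNorm_zorichQ (h : TypesAlternate γ) {a b k : ℕ} (hak : a ≤ k)
    (hkb : k < b) :
    ((zorichTime γ (k + 1) - zorichTime γ k : ℕ) : ℝ) ≤ entryNorm (zorichQ γ a b) := by
  have hmono := h.strictMono_zorichTime.monotone
  rw [zorichQ, h.prodFrom_zorichMatrix]
  refine le_trans ?_ (le_entryNorm_prodFrom _ _ _)
  have h1 := hmono hak
  have h2 := hmono (show k + 1 ≤ a + (b - a) by omega)
  exact_mod_cast (by omega)

/-- Subexponential growth of the number of elementary steps in the Zorich steps. -/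
lemma TypesAlternate.length_le_exp (h : TypesAlternate γ) {n κ : ℕ → ℕ} (hn : StrictMono n)
    (hκ : StrictMono κ)
    (hS : Tendsto (fun m : ℕ => Real.log (entryNorm (zorichQ γ (n (κ m)) (n (κ (m + 1))))) / m)
      atTop (𝓝 0)) {ε : ℝ} (hε : 0 < ε) :
    ∀ᶠ k : ℕ in atTop,
      ((zorichTime γ (k + 1) - zorichTime γ k : ℕ) : ℝ) ≤ Real.exp (ε * k) := by
  have hnκ : StrictMono fun m => n (κ m) := hn.comp hκ
  obtain ⟨M, hM⟩ := eventually_atTop.1 (hS.eventually (gt_mem_nhds hε))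
  filter_upwards [eventually_ge_atTop (n (κ (M + 1)))] with k hk
  have hfin : ∃ m, k < n (κ m) := ⟨k + 1, hnκ.le_apply (x := k + 1)⟩
  -- This selects `m` with `n (κ m) ≤ k < n (κ (m + 1))`. Starting from `n (κ (M + 1))` forces `m >
  -- M`, so the bound from Condition [S] applies and the division by `m` is legitimate. Then `m ≤ k`
  -- turns `ε * m` into `ε * k`.
  obtain ⟨m, hm⟩ : ∃ m, Nat.find hfin = m + 1 := Nat.exists_eq_succ_of_ne_zero fun h0 => by
    have := Nat.find_spec hfin
    rw [h0] at this
    have := hnκ.monotone (Nat.zero_le (M + 1))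
    omega
  have h1 : k < n (κ (m + 1)) := hm ▸ Nat.find_spec hfin
  have h2 : n (κ m) ≤ k := not_lt.1 (Nat.find_min hfin (by omega))
  have h3 : M + 1 ≤ m := by
    by_contra h3
    have := hnκ.monotone (show m + 1 ≤ M + 1 by omega)
    omega
  have h4 := hM m (by omega)
  have hm0 : (0 : ℝ) < m := by exact_mod_cast (by omega : 0 < m)
  rw [div_lt_iff₀ hm0] at h4
  have h5 := h.sub_le_entryNorm_zorichQ h2 h1
  have h6 : m ≤ k := (hnκ.le_apply (x := m)).trans h2
  have h7 : (1 : ℝ) ≤ ((zorichTime γ (k + 1) - zorichTime γ k : ℕ) : ℝ) := by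
    have := (h.zorichTime_spec k).1
    exact_mod_cast (by omega)
  refine h5.trans ((Real.log_le_iff_le_exp (by linarith)).1 (h4.le.trans ?_))
  exact mul_le_mul_of_nonneg_left (by exact_mod_cast h6) hε.le

end Cocycle

/-! ### Summability of the logarithmic slopes along the renormalization -/

namespace GIETData

variable {d : ℕ} [NeZero d] {T : GIETData d}

lemma IsC1GIET.iterate (h : T.IsC1GIET) (hd : 2 ≤ d) (hr : T.InfinitelyRenormalizable) (n : ℕ) :
    (GIETData.rauzyVeech^[n] T).IsC1GIET := by
  induction n with
  | zero => exact h
  | succ n ih =>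
    rw [Function.iterate_succ_apply']
    exact ih.rauzyVeech hd (hr n)

lemma winner_iterate_eq {N r : ℕ}
    (ht : ∀ n, N ≤ n → n ≤ N + r → (T.rotationNumber n).type = (T.rotationNumber N).type) :
    (T.rotationNumber (N + r)).winner = (T.rotationNumber N).winner := by
  induction r with
  | zero => rfl
  | succ r ih =>
    rw [← ih fun n h1 h2 => ht n h1 (by omega)]
    have h1 := (ht (N + (r + 1)) (by omega) le_rfl).trans (ht (N + r) (by omega) (by omega)).symm
    change (rauzyVeech^[N + r + 1] T).winType = (rauzyVeech^[N + r] T).winType at h1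
    change (rauzyVeech^[N + r + 1] T).arrow.winner = (rauzyVeech^[N + r] T).arrow.winner
    rw [Function.iterate_succ_apply'] at h1 ⊢
    exact winner_rauzyVeech h1

/-- If the type were constant from some time on, so would be the winner, whereas for `d ≥ 2` another
label must also win infinitely often. -/
lemma Irrational.typesAlternate (hT : T.Irrational) (hd : 2 ≤ d) :
    TypesAlternate T.rotationNumber := by
  intro N
  by_contra! hcon
  have ht : ∀ n, N ≤ n → (T.rotationNumber n).type = (T.rotationNumber N).type := fun n hn => by
    rcases hn.eq_or_lt with rfl | hn
    · rfl
    · exact hcon n hn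
  have : Nontrivial (Fin d) := Fin.nontrivial_iff_two_le.2 hd
  obtain ⟨j, hj⟩ := exists_ne (T.rotationNumber N).winner
  obtain ⟨n, hn, hn'⟩ := (frequently_atTop.1 (hT.2 j)) N
  obtain ⟨r, rfl⟩ := Nat.exists_eq_add_of_le hn
  exact hj (hn' ▸ winner_iterate_eq fun n h1 _ => ht n h1)

/-- Linear growth inside a Zorich block: the winner keeps its initial bound `c` throughout, and
every step adds at most `c` to the bound for the others. -/
lemma slopeSup_iterate_le (h : T.IsC1GIET) (hd : 2 ≤ d) (hr : T.InfinitelyRenormalizable)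
    {N r : ℕ}
    (ht : ∀ n, N ≤ n → n ≤ N + r → (T.rotationNumber n).type = (T.rotationNumber N).type) :
    (rauzyVeech^[N + r] T).slopeSup ≤ (1 + r) * (rauzyVeech^[N] T).slopeSup := by
  set c := (rauzyVeech^[N] T).slopeSup with hc
  have hc0 : 0 ≤ c := slopeSup_nonneg _
  have key : (rauzyVeech^[N + r] T).SlopeBound (T.rotationNumber N).winner c ∧
      ∀ i, (rauzyVeech^[N + r] T).SlopeBound i ((1 + r) * c) := by
    induction r with
    | zero =>
      have := (h.iterate hd hr N).slopeBound
      exact ⟨this _, fun i => by simpa using this i⟩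
    | succ r ih =>
      obtain ⟨ih1, ih2⟩ := ih fun n h1 h2 => ht n h1 (by omega)
      have hw := winner_iterate_eq (T := T) (N := N) (r := r) fun n h1 h2 => ht n h1 (by omega)
      rw [← hw] at ih1
      obtain ⟨h1, h2⟩ := slopeBound_rauzyVeech (h.iterate hd hr (N + r)) hd (hr _) hc0 ih1 ih2
      rw [← add_assoc, Function.iterate_succ_apply']
      refine ⟨hw ▸ h1, fun i => (h2 i).mono (le_of_eq ?_)⟩
      push_cast
      ring
  exact slopeSup_le (by positivity) key.2

/-- A block of length `L` has `L` terms, each at most `L` times the supremum at its start; hence the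
squares. -/
lemma sum_slopeSup_le (h : T.IsC1GIET) (hd : 2 ≤ d) (hT : T.Irrational) (k : ℕ) :
    ∑ n ∈ Finset.range (zorichTime T.rotationNumber k), (rauzyVeech^[n] T).slopeSup
      ≤ ∑ j ∈ Finset.range k, ((zorichTime T.rotationNumber (j + 1)
        - zorichTime T.rotationNumber j : ℕ) : ℝ) ^ 2 * (T.zorich j).slopeSup := by
  have hA := hT.typesAlternate hd
  induction k with
  | zero => simp [zorichTime]
  | succ k ih =>
    set N := zorichTime T.rotationNumber k with hN
    set N' := zorichTime T.rotationNumber (k + 1) with hN'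
    have hlt : N < N' := (hA.zorichTime_spec k).1
    rw [Finset.sum_range_succ _ k, ← hN, ← hN']
    have hsplit : N' = N + (N' - N) := by omega
    rw [hsplit, Finset.sum_range_add, ← hsplit]
    refine add_le_add ih ?_
    have hb : ∀ r ∈ Finset.range (N' - N), (rauzyVeech^[N + r] T).slopeSup
        ≤ ((N' - N : ℕ) : ℝ) * (T.zorich k).slopeSup := fun r hr => by
      rw [Finset.mem_range] at hr
      refine (slopeSup_iterate_le h hd hT.1 fun n h1 h2 =>
        type_eq_of_lt_zorichTime h1 (by omega)).trans ?_
      refine mul_le_mul_of_nonneg_right ?_ (slopeSup_nonneg _)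
      exact_mod_cast (by omega : 1 + r ≤ N' - N)
    refine (Finset.sum_le_card_nsmul _ _ _ hb).trans (le_of_eq ?_)
    rw [Finset.card_range, nsmul_eq_mul]
    ring

lemma summable_slopeSup (h : T.IsC1GIET) (hd : 2 ≤ d) (hRDC : T.SatisfiesRDC)
    (hconv : ∃ K₁ > (0 : ℝ), ∃ α₁ : ℝ, 0 < α₁ ∧ α₁ < 1 ∧
      ∀ n : ℕ, (T.zorich n).edistToIET ≤ ENNReal.ofReal (K₁ * α₁ ^ n)) :
    Summable fun n => (rauzyVeech^[n] T).slopeSup := by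
  obtain ⟨hT, Γ, -, n, ⟨-, hn, -⟩, -, κ, hκ, -, -, -, hS, -⟩ := hRDC
  obtain ⟨K, hK, a, ha0, ha1, hconv⟩ := hconv
  have hA := hT.typesAlternate hd
  set N := zorichTime T.rotationNumber with hN
  have hlog := Real.log_neg ha0 ha1
  -- With this rate the squared block length is at most `a ^ (-k / 2)`, leaving a geometric series
  -- of ratio `√a`.
  set ε := -Real.log a / 4 with hε
  have hlen := hA.length_le_exp hn hκ hS (ε := ε) (by linarith)
  -- The factor `2` turns the assumed bound on the distance into a strict inequality, as the slope
  -- estimate requires.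
  have hsmall : ∀ᶠ k : ℕ in atTop, 2 * K * a ^ k ≤ 1 / 2 := by
    have : Tendsto (fun k : ℕ => 2 * K * a ^ k) atTop (𝓝 (2 * K * 0)) :=
      (tendsto_pow_atTop_nhds_zero_of_lt_one ha0.le ha1).const_mul _
    rw [mul_zero] at this
    exact this.eventually (ge_mem_nhds (by norm_num))
  have hsum : Summable fun j => ((N (j + 1) - N j : ℕ) : ℝ) ^ 2 * (T.zorich j).slopeSup := by
    have hgeom : Summable fun k : ℕ => 8 * K * Real.exp (Real.log a / 2) ^ k :=
      (summable_geometric_of_lt_one (Real.exp_pos _).le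
        (Real.exp_lt_one_iff.2 (by linarith))).mul_left _
    refine hgeom.of_norm_bounded_eventually_nat ?_
    filter_upwards [hlen, hsmall] with k h1 h2
    have hk0 : 0 < K * a ^ k := by positivity
    have h3 : (T.zorich k).slopeSup ≤ 4 * (2 * K * a ^ k) := by
      refine (h.iterate hd hT.1 _).slopeSup_le_of_edistToIET_lt h2 ((hconv k).trans_lt ?_)
      rw [ENNReal.ofReal_lt_ofReal_iff] <;> linarith
    have h4 : ((N (k + 1) - N k : ℕ) : ℝ) ^ 2 ≤ Real.exp (ε * k) ^ 2 :=
      pow_le_pow_left₀ (Nat.cast_nonneg _) h1 2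
    rw [Real.norm_of_nonneg (mul_nonneg (sq_nonneg _) (slopeSup_nonneg _))]
    refine (mul_le_mul h4 h3 (slopeSup_nonneg _) (sq_nonneg _)).trans (le_of_eq ?_)
    have h5 : a ^ k = Real.exp (Real.log a * k) := by
      rw [mul_comm, Real.exp_nat_mul, Real.exp_log ha0]
    have h6 : Real.exp (ε * k) ^ 2 * Real.exp (Real.log a * k)
        = Real.exp (Real.log a / 2) ^ k := by
      rw [← Real.exp_nat_mul, ← Real.exp_nat_mul, ← Real.exp_add]
      congr 1
      rw [hε]
      push_cast
      ring
    rw [h5, ← h6]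
    ring
  refine summable_of_sum_range_le (c := ∑' j, ((N (j + 1) - N j : ℕ) : ℝ) ^ 2
    * (T.zorich j).slopeSup) (fun n => slopeSup_nonneg _) fun m => ?_
  refine le_trans ?_ ((sum_slopeSup_le h hd hT m).trans (hsum.sum_le_tsum _
    fun j _ => mul_nonneg (sq_nonneg _) (slopeSup_nonneg _)))
  exact Finset.sum_le_sum_of_subset_of_nonneg
    (Finset.range_mono hA.strictMono_zorichTime.le_apply) fun j _ _ => slopeSup_nonneg _

end GIETData

/-! ### Oscillation along a filter -/

/-- The oscillation of `φ` along the filter `F` is at most `ε`. -/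
def OscLE (φ : ℝ → ℝ) (F : Filter ℝ) (ε : ℝ) : Prop :=
  ∀ ε' > ε, ∀ᶠ p in F ×ˢ F, |φ p.1 - φ p.2| ≤ ε'

/-- A summand that has a limit along `F` contributes no oscillation, and pulling back along `s`
cannot create any. -/
lemma OscLE.of_eventuallyEq {φ φ' s h : ℝ → ℝ} {F G : Filter ℝ} {ε c : ℝ} (hO : OscLE φ' G ε)
    (hs : Tendsto s F G) (hφ : ∀ᶠ y in F, φ y = φ' (s y) + h y) (hh : Tendsto h F (𝓝 c)) :
    OscLE φ F ε := by
  intro ε' hε'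
  have hη : 0 < (ε' - ε) / 3 := by linarith
  have h1 : ∀ᶠ p in F ×ˢ F, |φ' (s p.1) - φ' (s p.2)| ≤ ε + (ε' - ε) / 3 :=
    (hs.prodMap hs).eventually (hO (ε + (ε' - ε) / 3) (by linarith))
  have h2 : ∀ᶠ y in F, |h y - c| ≤ (ε' - ε) / 3 := by
    filter_upwards [hh (Metric.ball_mem_nhds c hη)] with y hy
    rw [mem_preimage, Metric.mem_ball, Real.dist_eq] at hy
    exact hy.le
  have h3 := hφ.and h2
  filter_upwards [h1, h3.prod_mk h3] with p hp hq
  obtain ⟨⟨e1, b1⟩, e2, b2⟩ := hq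
  rw [e1, e2]
  rw [abs_le] at *
  constructor <;> linarith [hp.1, hp.2, b1.1, b1.2, b2.1, b2.2]

lemma OscLE.of_map {φ f : ℝ → ℝ} {F G : Filter ℝ} {ε : ℝ} (h : OscLE (φ ∘ f) F ε)
    (hG : G ≤ map f F) : OscLE φ G ε := by
  intro ε' hε'
  refine (Filter.prod_mono hG hG) ?_
  rw [Filter.prod_map_map_eq]
  exact h ε' hε'

lemma OscLE.of_abs_le {φ : ℝ → ℝ} {F : Filter ℝ} {c : ℝ} (h : ∀ᶠ y in F, |φ y| ≤ c) :
    OscLE φ F (2 * c) := by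
  intro ε' hε'
  filter_upwards [h.prod_mk h] with p hp
  linarith [abs_sub (φ p.1) (φ p.2), hp.1, hp.2]

/-- Zero oscillation is the Cauchy condition for the image filter. -/
lemma OscLE.exists_tendsto {φ : ℝ → ℝ} {F : Filter ℝ} [F.NeBot] (h : OscLE φ F 0) :
    ∃ c, Tendsto φ F (𝓝 c) := by
  refine CompleteSpace.complete (cauchy_map_iff.2 ⟨inferInstance, ?_⟩)
  rw [Metric.uniformity_basis_dist_le.tendsto_right_iff]
  exact fun ε hε => h ε hε

/-! ### The cohomological equation -/

namespace GIETData

variable {d : ℕ} {T : GIETData d}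

/-- `φ` solves the cohomological equation `φ ∘ T + log DT = φ` up to an error `ε`. -/
def CohomErr (T : GIETData d) (φ : ℝ → ℝ) (ε : ℝ) : Prop :=
  ∀ i, ∀ x ∈ Ico (T.topLeft i) (T.topRight i), |φ (T.branch i x) + T.logSlope i x - φ x| ≤ ε

lemma IsC1GIET.Ico_subset (h : T.IsC1GIET) (i : Fin d) :
    Ico (T.topLeft i) (T.topRight i) ⊆ Ico 0 1 :=
  Ico_subset_Ico (h.topLeft_nonneg i) (h.topRight_le_one i)

lemma IsC1GIET.branch_mem (h : T.IsC1GIET) {i : Fin d} {x : ℝ}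
    (hx : x ∈ Ico (T.topLeft i) (T.topRight i)) : T.branch i x ∈ Ico 0 1 :=
  Ico_subset_Ico (h.botLeft_nonneg i) (h.botRight_le_one i) ((h.diffeo i).mapsTo_Ico hx)

/-! ### The conjugacy -/

lemma IsC1GIET.map_eq (h : T.IsC1GIET) {x : ℝ} {i : Fin d}
    (hx : x ∈ Ico (T.topLeft i) (T.topRight i)) : T.map x = T.branch i x := by
  rw [map, Finset.sum_eq_single i, indicator_of_mem hx]
  · intro j _ hj
    exact indicator_of_notMem (fun hx' => hj (h.eq_of_mem hx' hx)) _
  · simp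

/-- A positive continuous density which is transported by `T` gives a conjugacy to a standard
IET. -/
theorem IsC1GIET.exists_c1Conjugate (h : T.IsC1GIET) {Φ : ℝ → ℝ} (hΦ : Continuous Φ)
    (hT : ∀ i, ∀ x ∈ Ico (T.topLeft i) (T.topRight i),
      Φ (T.branch i x) + T.logSlope i x = Φ x) :
    ∃ T₀ : GIETData d, T₀.IsIET ∧ T.C1Conjugate T₀ := by
  have hρ : Continuous fun x => Real.exp (Φ x) := Real.continuous_exp.comp hΦ
  set M := ∫ t in (0 : ℝ)..1, Real.exp (Φ t) with hM
  have hM0 : 0 < M := intervalIntegral.intervalIntegral_pos_of_pos (hρ.intervalIntegrable 0 1)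
    (fun x => Real.exp_pos _) zero_lt_one
  set ψ : ℝ → ℝ := fun x => (∫ t in (0 : ℝ)..x, Real.exp (Φ t)) / M with hψ
  have hder : ∀ x, HasDerivAt ψ (Real.exp (Φ x) / M) x := fun x =>
    (hρ.integral_hasStrictDerivAt 0 x).hasDerivAt.div_const M
  have hpos : ∀ x, 0 < Real.exp (Φ x) / M := fun x => div_pos (Real.exp_pos _) hM0
  have hψ0 : ψ 0 = 0 := by simp [hψ]
  have hψ1 : ψ 1 = 1 := div_self hM0.ne'
  have hderiv : deriv ψ = fun x => Real.exp (Φ x) / M := funext fun x => (hder x).deriv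
  have hC1 : ContDiff ℝ 1 ψ := by
    rw [contDiff_one_iff_deriv, hderiv]
    exact ⟨fun x => (hder x).differentiableAt, hρ.div_const M⟩
  have hmono : StrictMono ψ := strictMono_of_deriv_pos fun x => by
    rw [hderiv]; exact hpos x
  have hψd : IsC1Diffeo ψ 0 1 0 1 := by
    refine ⟨hC1.contDiffOn, fun x hx => ?_, hψ0, hψ1⟩
    rw [(hder x).hasDerivWithinAt.derivWithin (uniqueDiffOn_Icc zero_lt_one x hx)]
    exact hpos x
  -- The derivative of `ψ ∘ T_i - ψ` vanishes by the cohomological equation. That equation is given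
  -- on the half-open interval, so the argument uses right derivatives together with continuity on
  -- the closed one.
  have hconst : ∀ i, ∀ x ∈ Icc (T.topLeft i) (T.topRight i),
      ψ (T.branch i x) = ψ x + (ψ (T.botLeft i) - ψ (T.topLeft i)) := by
    intro i x hx
    have hcont : ContinuousOn (fun x => ψ (T.branch i x) - ψ x)
        (Icc (T.topLeft i) (T.topRight i)) :=
      (hC1.continuous.comp_continuousOn (h.diffeo i).continuousOn).sub hC1.continuous.continuousOn
    have := constant_of_has_deriv_right_zero hcont (fun y hy => ?_) x hx
    · simp only [(h.diffeo i).2.2.1] at this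
      linarith
    · have hyI := Ico_subset_Icc_self hy
      have h1 := ((h.diffeo i).hasDerivWithinAt hyI).mono_of_mem_nhdsWithin
        (Icc_mem_nhdsGE_of_mem hy)
      have h2 := ((hder (T.branch i y)).comp_hasDerivWithinAt y h1).sub
        (hder y).hasDerivWithinAt
      refine h2.congr_deriv ?_
      have hexp : derivWithin (T.branch i) (Icc (T.topLeft i) (T.topRight i)) y
          = Real.exp (T.logSlope i y) := (Real.exp_log ((h.diffeo i).2.1 y hyI)).symm
      rw [hexp, ← hT i y hy, Real.exp_add]
      ring
  -- Top and bottom lengths are given by the same expression, so their equality is definitional;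
  -- `hlenB` then recovers the `ψ`-lengths of the bottom intervals from `hconst` at right endpoints.
  set T₀ : GIETData d :=
    { comb := T.comb
      lenT := fun i => ψ (T.topRight i) - ψ (T.topLeft i)
      lenB := fun i => ψ (T.topRight i) - ψ (T.topLeft i)
      branch := fun i x => x + (ψ (T.botLeft i) - ψ (T.topLeft i)) } with hT₀
  have hlen : ∀ i, 0 < T₀.lenT i := fun i => sub_pos.2 (hmono (h.topLeft_lt i))
  have hlenB : T₀.lenB = fun i => ψ (T.botRight i) - ψ (T.botLeft i) := by
    funext i
    have := hconst i _ (right_mem_Icc.2 (h.topLeft_lt i).le)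
    rw [(h.diffeo i).2.2.2] at this
    change ψ (T.topRight i) - ψ (T.topLeft i) = _
    linarith
  have htl : ∀ i, T₀.topLeft i = ψ (T.topLeft i) := fun i =>
    leftSum_telescope T.comb.top T.lenT ψ hψ0 i
  have htr : ∀ i, T₀.topRight i = ψ (T.topRight i) := fun i => by
    rw [topRight, htl]
    change ψ (T.topLeft i) + (ψ (T.topRight i) - ψ (T.topLeft i)) = _
    ring
  have hbl : ∀ i, T₀.botLeft i = ψ (T.botLeft i) := fun i => by
    refine Eq.trans ?_ (leftSum_telescope T.comb.bot T.lenB ψ hψ0 i)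
    change leftSum T.comb.bot T₀.lenB i = _
    rw [hlenB]
    rfl
  have hbr : ∀ i, T₀.botRight i = ψ (T.botRight i) := fun i => by
    rw [botRight, hbl, hlenB]
    ring
  have hsum : ∑ i, T₀.lenT i = 1 := by
    rw [← hψ1, ← h.sum_lenT]
    exact sum_telescope T.comb.top T.lenT ψ hψ0
  refine ⟨T₀, ⟨⟨h.irreducible, hlen, hlen, hsum, hsum, fun i => ?_⟩, fun i => rfl,
    fun i => ⟨_, fun x _ => rfl⟩⟩, ψ, hψd, fun x hx => ?_⟩
  · have hlt := hmono (h.topLeft_lt i)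
    rw [htl, htr, hbl, hbr]
    refine ⟨(contDiff_id.add contDiff_const).contDiffOn, fun x hx => ?_, ?_, ?_⟩
    · have h1 : HasDerivWithinAt (T₀.branch i) 1
          (Icc (ψ (T.topLeft i)) (ψ (T.topRight i))) x := (hasDerivWithinAt_id x _).add_const _
      rw [h1.derivWithin (uniqueDiffOn_Icc hlt x hx)]
      exact one_pos
    · change ψ (T.topLeft i) + (ψ (T.botLeft i) - ψ (T.topLeft i)) = _
      ring
    · rw [← (h.diffeo i).2.2.2, hconst i _ (right_mem_Icc.2 (h.topLeft_lt i).le)]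
  · obtain ⟨i, hi⟩ := h.exists_mem hx
    have hi₀ : ψ x ∈ Ico (T₀.topLeft i) (T₀.topRight i) := by
      rw [htl, htr]
      exact ⟨hmono.monotone hi.1, hmono hi.2⟩
    have hmap : T₀.map (ψ x) = T₀.branch i (ψ x) := by
      rw [map, Finset.sum_eq_single i, indicator_of_mem hi₀]
      · intro j _ hj
        exact indicator_of_notMem (fun hx' => hj (eq_of_mem_Ico_leftSum T₀.comb.top
          (fun j => (hlen j).le) hx' hi₀)) _
      · simp
    rw [h.map_eq hi, hmap, hconst i x (Ico_subset_Icc_self hi)]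

/-! ### Lifting solutions through an elementary step -/

variable [NeZero d]

/-- The first entrance in the interval of induction, after rescaling. -/
def baseMap (T : GIETData d) (x : ℝ) : ℝ :=
  if x < T.cut then x / T.cut else T.branch (T.comb.top ⊤) x / T.cut

/-- The logarithmic slope of the passage to the interval of induction. -/
def baseSlope (T : GIETData d) (x : ℝ) : ℝ :=
  if x < T.cut then 0 else T.logSlope (T.comb.top ⊤) x

lemma IsStep.mem_top {R : GIETData d} {l : ℝ} (hs : T.IsStep R l) (h : T.IsC1GIET) {x : ℝ}
    (hx : x ∈ Ico l 1) : x ∈ Ico (T.topLeft (T.comb.top ⊤)) (T.topRight (T.comb.top ⊤)) := by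
  rw [h.topRight_top]
  exact ⟨hs.topLeft_le.trans hx.1, hx.2⟩

lemma IsStep.branch_top_lt {R : GIETData d} {l : ℝ} (hs : T.IsStep R l) (h : T.IsC1GIET) {x : ℝ}
    (hx : x ∈ Ico (T.topLeft (T.comb.top ⊤)) (T.topRight (T.comb.top ⊤))) :
    T.branch (T.comb.top ⊤) x < l :=
  ((h.diffeo _).lt_right hx).trans_le hs.botRight_le

lemma div_mem_Ico {l x : ℝ} (hx : x ∈ Ico 0 l) : x / l ∈ Ico (0 : ℝ) 1 := by
  have hl := hx.1.trans_lt hx.2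
  exact ⟨div_nonneg hx.1 hl.le, (div_lt_one hl).2 hx.2⟩

lemma baseMap_mem (h : T.IsC1GIET) (hd : 2 ≤ d) (hr : T.Renormalizable) {x : ℝ}
    (hx : x ∈ Ico (0 : ℝ) 1) : T.baseMap x ∈ Ico (0 : ℝ) 1 := by
  have hs := isStep_induced h hd hr
  unfold baseMap
  split_ifs with hxl
  · exact div_mem_Ico ⟨hx.1, hxl⟩
  · have hm := hs.mem_top h ⟨not_lt.1 hxl, hx.2⟩
    exact div_mem_Ico ⟨(h.branch_mem hm).1, hs.branch_top_lt h hm⟩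

lemma abs_baseSlope_le (h : T.IsC1GIET) (hd : 2 ≤ d) (hr : T.Renormalizable) {x : ℝ}
    (hx : x ∈ Ico (0 : ℝ) 1) : |T.baseSlope x| ≤ T.slopeSup := by
  have hs := isStep_induced h hd hr
  unfold baseSlope
  split_ifs with hxl
  · rw [abs_zero]; exact slopeSup_nonneg T
  · exact h.slopeBound _ x (Ico_subset_Icc_self (hs.mem_top h ⟨not_lt.1 hxl, hx.2⟩))

/-- If `x` and its image are both below the cut, or only `x` is, the equation at `x` is the
renormalized equation at `x / T.cut`, for a return at time one or two. If `x` is above the cut, it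
holds exactly by the way `φ` extends `φ'`. -/
lemma CohomErr.lift {φ φ' : ℝ → ℝ} {ε : ℝ} (hφ' : T.rauzyVeech.CohomErr φ' ε) (h : T.IsC1GIET)
    (hd : 2 ≤ d) (hr : T.Renormalizable)
    (hφ : ∀ x ∈ Ico (0 : ℝ) 1, φ x = φ' (T.baseMap x) + T.baseSlope x) (hε : 0 ≤ ε) :
    T.CohomErr φ ε := by
  have hs := isStep_induced h hd hr
  have hlow : ∀ x ∈ Ico (0 : ℝ) 1, x < T.cut → φ x = φ' (x / T.cut) := fun x hx hxl => by
    rw [hφ x hx, baseMap, baseSlope, if_pos hxl, if_pos hxl, add_zero]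
  have hhigh : ∀ x ∈ Ico (0 : ℝ) 1, T.cut ≤ x → φ x
      = φ' (T.branch (T.comb.top ⊤) x / T.cut) + T.logSlope (T.comb.top ⊤) x := fun x hx hxl => by
    rw [hφ x hx, baseMap, baseSlope, if_neg hxl.not_gt, if_neg hxl.not_gt]
  have hR : ∀ i, ∀ x ∈ Ico (T.induced.topLeft i) (T.induced.topRight i),
      |φ' (T.induced.branch i x / T.cut) + (T.induced.rescale T.cut).logSlope i (x / T.cut)
        - φ' (x / T.cut)| ≤ ε := fun i x hx => by
    rw [rauzyVeech_eq] at hφ'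
    have := hφ' i (x / T.cut) (by
      rw [topLeft_rescale, topRight_rescale]
      exact ⟨div_le_div_of_nonneg_right hx.1 hs.pos.le, div_lt_div_of_pos_right hx.2 hs.pos⟩)
    change |φ' (T.induced.branch i (T.cut * (x / T.cut)) / T.cut) + _ - _| ≤ ε at this
    rwa [mul_div_cancel₀ _ hs.pos.ne'] at this
  intro i x hx
  have hx1 := h.Ico_subset i hx
  have hy1 := h.branch_mem hx
  rcases lt_or_ge x T.cut with hxl | hxl
  · rcases lt_or_ge (T.branch i x) T.cut with hy | hy
    · obtain ⟨hi, hxR⟩ := hs.mem_of_lt i x hx hxl hy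
      have := hR i x hxR
      rw [hs.branch_ne i hi, hs.logSlope_ne h hi (Ico_subset_Icc_self hxR)] at this
      rwa [hlow x hx1 hxl, hlow _ hy1 hy]
    · obtain ⟨rfl, hxR⟩ := hs.mem_of_le i x hx hxl hy
      have := hR _ x hxR
      rw [hs.branch_loser, hs.logSlope_loser h (Ico_subset_Icc_self hxR)] at this
      rwa [hlow x hx1 hxl, hhigh _ hy1 hy, add_assoc]
  · obtain rfl := h.eq_of_mem hx (hs.mem_top h ⟨hxl, hx1.2⟩)
    rw [hhigh x hx1 hxl, hlow _ hy1 (hs.branch_top_lt h hx), sub_self, abs_zero]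
    exact hε

/-- Near each point, `φ` is expressed through `φ'` near one other point, plus a continuous
logarithmic slope. The exact equation is needed to have one expression on both sides of the cut. -/
lemma oscLE_lift {φ φ' : ℝ → ℝ} {ε : ℝ} (h : T.IsC1GIET) (hd : 2 ≤ d) (hr : T.Renormalizable)
    (hφ : ∀ x ∈ Ico (0 : ℝ) 1, φ x = φ' (T.baseMap x) + T.baseSlope x) (hc : T.CohomErr φ 0)
    (hO : ∀ x ∈ Icc (0 : ℝ) 1, OscLE φ' (𝓝[Ico 0 1] x) ε) :
    ∀ x ∈ Icc (0 : ℝ) 1, OscLE φ (𝓝[Ico 0 1] x) ε := by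
  have hs := isStep_induced h hd hr
  have hne := h.irreducible.top_ne_bot hd
  have hlow : ∀ x ∈ Ico (0 : ℝ) 1, x < T.cut → φ x = φ' (x / T.cut) := fun x hx hxl => by
    rw [hφ x hx, baseMap, baseSlope, if_pos hxl, if_pos hxl, add_zero]
  have heq : ∀ i, ∀ x ∈ Ico (T.topLeft i) (T.topRight i),
      φ (T.branch i x) + T.logSlope i x = φ x := fun i x hx =>
    sub_eq_zero.1 (abs_nonpos_iff.1 (hc i x hx))
  have hdiv : Continuous fun y : ℝ => y / T.cut := continuous_id.div_const _
  intro x hx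
  have hmem : ∀ᶠ y in 𝓝[Ico (0 : ℝ) 1] x, y ∈ Ico (0 : ℝ) 1 := self_mem_nhdsWithin
  rcases lt_or_ge x T.cut with hxl | hxl
  · have hlt : ∀ᶠ y in 𝓝[Ico (0 : ℝ) 1] x, y < T.cut :=
      nhdsWithin_le_nhds (Iio_mem_nhds hxl)
    refine (hO (x / T.cut) (Ico_subset_Icc_self (div_mem_Ico ⟨hx.1, hxl⟩))).of_eventuallyEq
      (s := fun y => y / T.cut) (h := fun _ => 0) (c := 0) ?_ ?_ tendsto_const_nhds
    · refine tendsto_nhdsWithin_of_tendsto_nhds_of_eventually_within _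
        (hdiv.continuousAt.tendsto.mono_left nhdsWithin_le_nhds) ?_
      filter_upwards [hmem, hlt] with y hy hyl
      exact div_mem_Ico ⟨hy.1, hyl⟩
    · filter_upwards [hmem, hlt] with y hy hyl
      rw [hlow y hy hyl, add_zero]
  -- Inside the last top interval, or at its right end `1`, the equation for that branch gives a
  -- formula valid on both sides of the cut, where `baseMap` may jump.
  by_cases htx : T.topLeft (T.comb.top ⊤) < x
  · set α := T.comb.top ⊤ with hα
    have hα1 : T.topRight α = 1 := h.topRight_top
    have hgt : ∀ᶠ y in 𝓝[Ico (0 : ℝ) 1] x, y ∈ Ico (T.topLeft α) (T.topRight α) := by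
      filter_upwards [hmem, nhdsWithin_le_nhds (Ioi_mem_nhds htx)] with y hy hyt
      rw [hα1]
      exact ⟨le_of_lt hyt, hy.2⟩
    have hle : 𝓝[Ico (0 : ℝ) 1] x ≤ 𝓝[Icc (T.topLeft α) (T.topRight α)] x :=
      le_inf nhdsWithin_le_nhds (le_principal_iff.2
        (hgt.mono fun y hy => Ico_subset_Icc_self hy))
    have hxI : x ∈ Icc (T.topLeft α) (T.topRight α) := ⟨htx.le, hα1 ▸ hx.2⟩
    have hT := (h.diffeo α).mapsTo_Icc hxI
    have hbl := h.botLeft_nonneg α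
    have hbr : T.botRight α ≤ T.cut := hs.botRight_le
    have hsx : T.branch α x / T.cut ∈ Icc (0 : ℝ) 1 :=
      ⟨div_nonneg (hbl.trans hT.1) hs.pos.le, (div_le_one hs.pos).2 (hT.2.trans hbr)⟩
    refine (hO _ hsx).of_eventuallyEq (s := fun y => T.branch α y / T.cut)
      (h := T.logSlope α) ?_ ?_ ((h.continuousOn_logSlope α x hxI).mono_left hle)
    · refine tendsto_nhdsWithin_of_tendsto_nhds_of_eventually_within _
        ((((h.diffeo α).continuousOn x hxI).mono_left hle).div_const _) ?_
      filter_upwards [hgt] with y hy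
      exact div_mem_Ico ⟨(h.branch_mem hy).1, hs.branch_top_lt h hy⟩
    · filter_upwards [hgt] with y hy
      rw [← heq α y hy, hlow _ (h.branch_mem hy) (hs.branch_top_lt h hy)]
  -- The remaining point is the cut when bottom wins, a singularity of `T` but an interior point of
  -- the last bottom interval. The equation at its preimage `z`, interior to the top interval `β`
  -- below the cut, controls `φ` on both sides.
  · obtain ⟨hl, hβl⟩ := hs.cases_l.resolve_left fun h' => htx (h'.trans_le hxl)
    obtain rfl : x = T.cut := le_antisymm (by rw [hl]; exact not_lt.1 htx) hxl
    set β := T.comb.bot ⊤ with hβ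
    obtain ⟨z, hz, hzl⟩ := (h.diffeo β).exists_preimage (h.topLeft_lt β).le
      (y := T.cut) ⟨hβl, by rw [h.botRight_bot]; exact hs.lt_one⟩
    have hβT : T.topRight β ≤ T.cut := by rw [hl]; exact h.topRight_le hne.symm
    have hnear : ∀ᶠ w in 𝓝 z, w ∈ Ico (T.topLeft β) (T.topRight β) :=
      mem_of_superset (Ioo_mem_nhds hz.1 hz.2) Ioo_subset_Ico_self
    have hzI := Ioo_subset_Icc_self hz
    have hmemI : ∀ w ∈ Ico (T.topLeft β) (T.topRight β), w ∈ Ico 0 T.cut := fun w hw =>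
      ⟨(h.Ico_subset β hw).1, hw.2.trans_le hβT⟩
    have hcont : Tendsto (fun w => -T.logSlope β w) (𝓝 z) (𝓝 (-T.logSlope β z)) :=
      ((h.continuousOn_logSlope β).continuousAt (Icc_mem_nhds hz.1 hz.2)).neg
    have hzO := hO (z / T.cut) (Ico_subset_Icc_self (div_mem_Ico (hmemI z ⟨hz.1.le, hz.2⟩)))
    refine OscLE.of_map (f := T.branch β) (F := 𝓝 z) (hzO.of_eventuallyEq
      (s := fun w => w / T.cut) (h := fun w => -T.logSlope β w) ?_ ?_ hcont) ?_
    · refine tendsto_nhdsWithin_of_tendsto_nhds_of_eventually_within _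
        hdiv.continuousAt.tendsto ?_
      filter_upwards [hnear] with w hw
      exact div_mem_Ico (hmemI w hw)
    · filter_upwards [hnear] with w hw
      rw [← hlow w (h.Ico_subset β hw) (hmemI w hw).2, ← heq β w hw, Function.comp_apply]
      ring
    · rw [← hzl]
      exact nhdsWithin_le_nhds.trans ((h.diffeo β).nhds_le_map hz)

/-! ### The transfer function -/

/-- The terms of the series of the transfer function. -/
def transferTerm (T : GIETData d) (x : ℝ) : ℕ → ℝ
  | 0 => T.baseSlope x
  | k + 1 => transferTerm T.rauzyVeech (T.baseMap x) k

/-- The solution of the cohomological equation. -/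
def transfer (T : GIETData d) (x : ℝ) : ℝ := ∑' k, T.transferTerm x k

/-- Infinitely renormalizable GIETs whose renormalizations have summable logarithmic slopes. -/
structure SummableSlopes (T : GIETData d) : Prop where
  giet : T.IsC1GIET
  renorm : T.InfinitelyRenormalizable
  summable : Summable fun n => (rauzyVeech^[n] T).slopeSup

/-- The sum of the logarithmic slopes along the renormalization. -/
def totalSlope (T : GIETData d) : ℝ := ∑' n, (rauzyVeech^[n] T).slopeSup

/-! ### Convergence of the transfer series, exactness of the solution, continuity. -/

namespace SummableSlopes

lemma renormalizable (h : T.SummableSlopes) : T.Renormalizable := h.renorm 0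

lemma next (h : T.SummableSlopes) (hd : 2 ≤ d) : T.rauzyVeech.SummableSlopes :=
  ⟨h.giet.rauzyVeech hd h.renormalizable, fun n => h.renorm (n + 1),
    (summable_nat_add_iff 1).2 h.summable⟩

lemma abs_transferTerm_le (hd : 2 ≤ d) (k : ℕ) : ∀ {T : GIETData d}, T.SummableSlopes →
    ∀ {x : ℝ}, x ∈ Ico (0 : ℝ) 1 → |T.transferTerm x k| ≤ (rauzyVeech^[k] T).slopeSup := by
  induction k with
  | zero => exact fun h x hx => abs_baseSlope_le h.giet hd h.renormalizable hx
  | succ k ih =>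
    exact fun h x hx => ih (h.next hd) (baseMap_mem h.giet hd h.renormalizable hx)

lemma summable_transferTerm (h : T.SummableSlopes) (hd : 2 ≤ d) {x : ℝ}
    (hx : x ∈ Ico (0 : ℝ) 1) : Summable (T.transferTerm x) :=
  h.summable.of_norm_bounded fun k => abs_transferTerm_le hd k h hx

lemma abs_transfer_le (h : T.SummableSlopes) (hd : 2 ≤ d) {x : ℝ} (hx : x ∈ Ico (0 : ℝ) 1) :
    |T.transfer x| ≤ T.totalSlope :=
  tsum_of_norm_bounded (f := T.transferTerm x) h.summable.hasSum fun k =>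
    abs_transferTerm_le hd k h hx

lemma transfer_eq (h : T.SummableSlopes) (hd : 2 ≤ d) {x : ℝ} (hx : x ∈ Ico (0 : ℝ) 1) :
    T.transfer x = T.rauzyVeech.transfer (T.baseMap x) + T.baseSlope x := by
  rw [transfer, (h.summable_transferTerm hd hx).tsum_eq_zero_add, add_comm]
  rfl

lemma slopeSup_le_totalSlope (h : T.SummableSlopes) : T.slopeSup ≤ T.totalSlope :=
  h.summable.le_tsum 0 fun _ _ => slopeSup_nonneg _

/-- These are the tails of one convergent series. -/
lemma tendsto_totalSlope (T : GIETData d) :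
    Tendsto (fun n => (rauzyVeech^[n] T).totalSlope) atTop (𝓝 0) := by
  have := tendsto_sum_nat_add fun n => (rauzyVeech^[n] T).slopeSup
  refine this.congr fun n => ?_
  unfold totalSlope
  simp only [Function.iterate_add_apply]

lemma totalSlope_nonneg (T : GIETData d) : 0 ≤ T.totalSlope :=
  tsum_nonneg fun _ => slopeSup_nonneg _

/-- Each of the three terms of the equation for the `n`-th renormalization is bounded by its total
slope, hence the `3`; lifting through the `n` steps loses nothing. -/
lemma cohomErr_aux (hd : 2 ≤ d) (n : ℕ) : ∀ {T : GIETData d}, T.SummableSlopes →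
    T.CohomErr T.transfer (3 * (rauzyVeech^[n] T).totalSlope) := by
  induction n with
  | zero =>
    intro T h i x hx
    have h1 := h.abs_transfer_le hd (h.giet.Ico_subset i hx)
    have h2 := h.abs_transfer_le hd (h.giet.branch_mem hx)
    have h3 := (h.giet.slopeBound i x (Ico_subset_Icc_self hx)).trans h.slopeSup_le_totalSlope
    rw [Function.iterate_zero, id, abs_le] at *
    constructor <;> linarith [h1.1, h1.2, h2.1, h2.2, h3.1, h3.2]
  | succ n ih =>
    intro T h
    exact (ih (h.next hd)).lift h.giet hd h.renormalizable (fun x hx => h.transfer_eq hd hx)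
      (mul_nonneg (by norm_num) (totalSlope_nonneg _))

lemma cohomErr (h : T.SummableSlopes) (hd : 2 ≤ d) : T.CohomErr T.transfer 0 := by
  intro i x hx
  have ht := (tendsto_totalSlope T).const_mul 3
  rw [mul_zero] at ht
  exact ge_of_tendsto' ht fun n => cohomErr_aux hd n h i x hx

/-- The transfer function of the `n`-th renormalization is bounded by its total slope, so it
oscillates by at most twice that, and `oscLE_lift` carries the bound down. -/
lemma oscLE_aux (hd : 2 ≤ d) (n : ℕ) : ∀ {T : GIETData d}, T.SummableSlopes →
    ∀ x ∈ Icc (0 : ℝ) 1,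
      OscLE T.transfer (𝓝[Ico 0 1] x) (2 * (rauzyVeech^[n] T).totalSlope) := by
  induction n with
  | zero =>
    intro T h x _
    refine OscLE.of_abs_le ?_
    filter_upwards [self_mem_nhdsWithin] with y hy
    exact h.abs_transfer_le hd hy
  | succ n ih =>
    intro T h
    exact oscLE_lift h.giet hd h.renormalizable (fun x hx => h.transfer_eq hd hx)
      (h.cohomErr hd) (ih (h.next hd))

lemma oscLE (h : T.SummableSlopes) (hd : 2 ≤ d) {x : ℝ} (hx : x ∈ Icc (0 : ℝ) 1) :
    OscLE T.transfer (𝓝[Ico 0 1] x) 0 := by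
  intro ε hε
  have ht := (tendsto_totalSlope T).const_mul 2
  rw [mul_zero] at ht
  obtain ⟨n, hn⟩ := (ht.eventually (gt_mem_nhds hε)).exists
  exact oscLE_aux hd n h x hx ε hn

/-- The transfer function extends to a continuous function. -/
lemma exists_continuous (h : T.SummableSlopes) (hd : 2 ≤ d) :
    ∃ Φ : ℝ → ℝ, Continuous Φ ∧ ∀ x ∈ Ico (0 : ℝ) 1, Φ x = T.transfer x := by
  have hcl : closure (Ico (0 : ℝ) 1) = Icc 0 1 := closure_Ico zero_ne_one
  have hlim : ∀ x ∈ Icc (0 : ℝ) 1, ∃ c, Tendsto T.transfer (𝓝[Ico 0 1] x) (𝓝 c) := by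
    intro x hx
    have : (𝓝[Ico (0 : ℝ) 1] x).NeBot := mem_closure_iff_nhdsWithin_neBot.1 (hcl ▸ hx)
    exact (h.oscLE hd hx).exists_tendsto
  have hcont := continuousOn_extendFrom hcl.ge hlim
  refine ⟨fun x => extendFrom (Ico 0 1) T.transfer (projIcc (0 : ℝ) 1 zero_le_one x),
    hcont.comp_continuous (continuous_subtype_val.comp continuous_projIcc) fun x => Subtype.mem _,
    fun x hx => ?_⟩
  have hx' := Ico_subset_Icc_self hx
  simp only [projIcc_of_mem zero_le_one hx']
  obtain ⟨c, hc⟩ := hlim x hx'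
  -- The filter includes the point `x` itself, so the limit there must be the value and the
  -- extension agrees with the series.
  have hxc : T.transfer x = c :=
    tendsto_nhds_unique (tendsto_pure_nhds T.transfer x) (hc.mono_left (pure_le_nhdsWithin hx))
  exact extendFrom_eq (hcl ▸ hx') (hxc ▸ hc)

end SummableSlopes

end GIETData

end GIETRigidity

end

theorem mainTheorem9 (d : ℕ) [NeZero d] (hd : 2 ≤ d) (T : GIETRigidity.GIETData d)
    (hT : T.IsC1GIET) (hRDC : T.SatisfiesRDC)
    (hconv : ∃ K₁ > (0 : ℝ), ∃ α₁ : ℝ, 0 < α₁ ∧ α₁ < 1 ∧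
      ∀ n : ℕ, (T.zorich n).edistToIET ≤ ENNReal.ofReal (K₁ * α₁ ^ n)) :
    ∃ T₀ : GIETRigidity.GIETData d, T₀.IsIET ∧ T.C1Conjugate T₀ := by
  have hs : T.SummableSlopes :=
    ⟨hT, hRDC.1.1, GIETRigidity.GIETData.summable_slopeSup hT hd hRDC hconv⟩
  obtain ⟨Φ, hΦ, hΦT⟩ := hs.exists_continuous hd
  refine hT.exists_c1Conjugate hΦ fun i x hx => ?_
  rw [hΦT _ (hT.branch_mem hx), hΦT x (hT.Ico_subset i hx)]
  exact sub_eq_zero.1 (abs_nonpos_iff.1 (hs.cohomErr hd i x hx))
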